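/- For integers $k,n\ge 1$, the book graph $B_n^{(k)}$ consists of $n$ copies of $K_{k+1}$ joined along a common $K_k$. Let $r(B_n^{(k)})$ be its Ramsey number, that is, the least $N$ such that every red/blue coloring of the edges of $K_N$ contains a monochromatic copy of $B_n^{(k)}$. All logarithms are to base $2$. Theorem. Fix an integer $k \ge 3$. Then, for every integer $n \ge 2^{2^{2^{k^{25k^2}2^{100k^3}}}}$, $$r(B_n^{(k)}) \le 2^k n + \frac{n}{(\log\log\log n)^{1/25}}.$$ Moreover, as $n\to\infty$ with $k$ fixed, $$r(B_n^{(k)}) = 2^k n + O_k\!\left(\frac{n}{(\log\log\log n)^{1/25}}\right),$$ where the implied constant depends only on $k$. -/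

import Mathlib

/-- The book graph `B_n^{(k)}`: `n` copies of `K_{k+1}` joined along a common `K_k`.
The vertices `Sum.inl i` form the spine (the common `K_k`), and the vertices `Sum.inr j` are the
`n` pages. Two distinct vertices are adjacent exactly when at least one of them is on the spine. -/
def bookGraph (k n : ℕ) : SimpleGraph (Fin k ⊕ Fin n) where
  Adj x y := x ≠ y ∧ (x.isLeft ∨ y.isLeft)
  symm := ⟨fun _ _ h => ⟨h.1.symm, h.2.symm⟩⟩
  loopless := ⟨fun _ h => h.1 rfl⟩

/-- Every red/blue coloring of the edges of `K_N` (label `0` is red, label `1` is blue) contains a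
red copy of `H₁` or a blue copy of `H₂`. -/
def IsRamsey {α β : Type*} (H₁ : SimpleGraph α) (H₂ : SimpleGraph β) (N : ℕ) : Prop :=
  ∀ C : SimpleGraph.TopEdgeLabeling (Fin N) (Fin 2),
    H₁.IsContained (C.labelGraph 0) ∨ H₂.IsContained (C.labelGraph 1)

/-- The Ramsey number `r(H₁, H₂)`: the least `N` such that every red/blue coloring of the edges of
`K_N` contains a red copy of `H₁` or a blue copy of `H₂`. For finite graphs the set below is
nonempty, see `exists_isRamsey`, so this is a genuine minimum. -/
noncomputable def ramseyNumber₂ {α β : Type*} (H₁ : SimpleGraph α) (H₂ : SimpleGraph β) : ℕ :=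
  sInf {N : ℕ | IsRamsey H₁ H₂ N}

/-- The diagonal Ramsey number `r(H) = r(H, H)`. -/
noncomputable def ramseyNumber {α : Type*} (H : SimpleGraph α) : ℕ :=
  ramseyNumber₂ H H

/-- Ramsey's theorem for two colors, in terms of cliques and independent sets. -/
theorem exists_clique_or_indep (a b : ℕ) :
    ∃ N : ℕ, ∀ (M : ℕ) (G : SimpleGraph (Fin M)) (S : Finset (Fin M)), N ≤ S.card →
      ∃ T ⊆ S, G.IsNClique a T ∨ Gᶜ.IsNClique b T := by
  classical
  induction a generalizing b with
  | zero => exact ⟨0, fun M G S _ => ⟨∅, by simp, Or.inl (by simp)⟩⟩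
  | succ a iha =>
    induction b with
    | zero => exact ⟨0, fun M G S _ => ⟨∅, by simp, Or.inr (by simp)⟩⟩
    | succ b ihb =>
      obtain ⟨N₁, h₁⟩ := iha (b + 1)
      obtain ⟨N₂, h₂⟩ := ihb
      refine ⟨N₁ + N₂ + 1, fun M G S hS => ?_⟩
      obtain ⟨v, hv⟩ : S.Nonempty := Finset.card_pos.mp (by omega)
      have hcard : ((S.erase v).filter (fun w => G.Adj v w)).card
          + ((S.erase v).filter (fun w => ¬ G.Adj v w)).card = S.card - 1 := by
        rw [Finset.card_filter_add_card_filter_not, Finset.card_erase_of_mem hv]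
      rcases le_or_gt N₁ ((S.erase v).filter (fun w => G.Adj v w)).card with h | h
      · obtain ⟨T, hT, hc⟩ := h₁ M G _ h
        have hTS : T ⊆ S := fun w hw =>
          Finset.mem_of_mem_erase (Finset.mem_filter.mp (hT hw)).1
        rcases hc with hc | hc
        · refine ⟨insert v T, Finset.insert_subset hv hTS, Or.inl (hc.insert fun w hw => ?_)⟩
          exact (Finset.mem_filter.mp (hT hw)).2
        · exact ⟨T, hTS, Or.inr hc⟩
      · obtain ⟨T, hT, hc⟩ := h₂ M G
          ((S.erase v).filter (fun w => ¬ G.Adj v w)) (by omega)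
        have hTS : T ⊆ S := fun w hw =>
          Finset.mem_of_mem_erase (Finset.mem_filter.mp (hT hw)).1
        rcases hc with hc | hc
        · exact ⟨T, hTS, Or.inl hc⟩
        · refine ⟨insert v T, Finset.insert_subset hv hTS, Or.inr (hc.insert fun w hw => ?_)⟩
          have hw' := Finset.mem_filter.mp (hT hw)
          exact (SimpleGraph.compl_adj _ _ _).mpr
            ⟨(Finset.ne_of_mem_erase hw'.1).symm, hw'.2⟩

/-- A finite graph is contained in every graph that has a clique of the same order. -/
theorem isContained_of_isNClique {γ : Type*} [Finite γ] (H : SimpleGraph γ) {M : ℕ}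
    (G : SimpleGraph (Fin M)) (T : Finset (Fin M)) (hT : G.IsNClique (Nat.card γ) T) :
    H.IsContained G := by
  have e : γ ≃ T := (Finite.equivFin γ).trans ((finCongr hT.card_eq.symm).trans T.equivFin.symm)
  refine ⟨⟨⟨fun x => (e x : Fin M), ?_⟩, fun x y h => e.injective (Subtype.ext h)⟩⟩
  intro x y hxy
  exact hT.isClique (e x).2 (e y).2 fun h => hxy.ne (e.injective (Subtype.ext h))

/-- Ramsey numbers of finite graphs are finite. -/
theorem exists_isRamsey {α β : Type*} [Finite α] [Finite β]
    (H₁ : SimpleGraph α) (H₂ : SimpleGraph β) : ∃ N : ℕ, IsRamsey H₁ H₂ N := by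
  classical
  obtain ⟨N, hN⟩ := exists_clique_or_indep (Nat.card β) (Nat.card α)
  refine ⟨N, fun C => ?_⟩
  have h0 : C.labelGraph 0 = (C.labelGraph 1)ᶜ := by
    rw [← SimpleGraph.toTopEdgeLabeling_labelGraph_compl,
      SimpleGraph.TopEdgeLabeling.labelGraph_toTopEdgeLabeling]
  obtain ⟨T, -, hT | hT⟩ := hN N (C.labelGraph 1) Finset.univ (by simp)
  · exact Or.inr (isContained_of_isNClique H₂ _ T hT)
  · exact Or.inl (isContained_of_isNClique H₁ _ T (h0 ▸ hT))

/-!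
The upper bound needs no regularity lemma. Suppose the edges of `K_N` are colored without a
monochromatic book `B_n^{(k)}`, where `N` is slightly larger than `2 ^ k * n`.

Call a family of `k` red cliques, any two of which are joined completely in blue, a multipartite
family (`IsMultipartite`), with cliques of large order `s`. Such a family gives the bound on `N` by
double counting (`BookFree.card_mul_two_le`). The red `k`-subsets of each clique and the blue
transversals of the family are monochromatic `k`-cliques, so each of them has fewer than `n` common
neighbors in its color. A vertex with a proportion `x i` of blue edges to the `i`-th clique is
joined in blue to a proportion `∏ i, x i` of the transversals and in red to about `(1 - x i) ^ k` of
the `k`-subsets of the `i`-th clique. As `∏ i, x i + (1 / k) * ∑ i, (1 - x i) ^ k ≥ 2 ^ (1 - k)` for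
`k ≥ 3` (`two_le_prod_add_sum_pow`), averaging over the vertices gives
`N * 2 ^ (1 - k) ≤ 2 * n` up to an error of relative size `O_k(1 / s)`.

A multipartite family is built greedily, in both colors at once
(`BookFree.exists_isMultipartite_succ`). A vertex with blue degree less than `|Q| / (4 k)` to a red
clique `Q` is joined in red to most `k`-subsets of `Q`, and each `k`-subset has fewer than
`n ≤ N / 2 ^ k` common red neighbors; so `Q` excludes at most about `4 / 3 * N / 2 ^ k` vertices. With
at most `2 * (k - 1)` cliques so far, a constant proportion of the vertices is not excluded. Among
these, take a large set of vertices with the same neighbors in all the cliques, and in this set a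
monochromatic clique, say red, by Ramsey's theorem. Restricting the old red cliques to the blue
neighborhood of this new clique gives one more red clique, and shrinks the others only by a factor
of `4 k`. After `2 k` steps there are `k` cliques of one color. This requires `N` to be only
exponential in `s`, so the triply exponential lower bound on `n` leaves plenty of room for
`s ≈ 2 ^ (2 * k + 1) * k ^ 2 * (log log log n) ^ (1 / 25)`.

The lower bound is the first moment method for a uniformly random coloring with
`N ≤ 2 ^ k * (n - n ^ (3 / 4))`: the number of pages on a fixed spine is binomial, and its exponential
moment (`sum_one_add_pow_card_pages`) makes `n` pages much less likely than `N ^ (-k)`.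
-/

/-! ### An inequality for densities -/

/-- The case `k = 3` of `one_sub_mul_log_le_two_sub_pow` to the left of the point of tangency. -/
theorem one_sub_three_mul_log_le {u : ℝ} (hu : 1 / 4 ≤ u) (hu1 : u ≤ 1) :
    1 - 3 * Real.log u ≤ (2 - u) ^ 3 := by
  rcases le_or_gt u (2 / 5) with h | h
  · -- Near `1/4` compare with the value of the logarithm there.
    have h4 : Real.log u = Real.log (4 * u) - 2 * Real.log 2 := by
      rw [Real.log_mul (by norm_num) (by linarith), show (4 : ℝ) = 2 ^ 2 by norm_num,
        Real.log_pow]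
      push_cast; ring
    have h5 := Real.one_sub_inv_le_log_of_pos (x := 4 * u) (by linarith)
    have h6 := Real.log_two_lt_d9
    have h7 : (4 * u)⁻¹ * (4 * u) = 1 := inv_mul_cancel₀ (by linarith)
    have h8 : (4 * u)⁻¹ ≤ ((2 - u) ^ 3 - 1) / 3 + 1 - 2 * 0.6931471808 := by
      rw [inv_le_iff_one_le_mul₀ (by linarith)]
      nlinarith [mul_nonneg (sub_nonneg.2 hu) (sub_nonneg.2 h),
        mul_nonneg (mul_nonneg (sub_nonneg.2 hu) (sub_nonneg.2 h)) (sub_nonneg.2 hu),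
        mul_nonneg (mul_nonneg (sub_nonneg.2 hu) (sub_nonneg.2 h)) (sub_nonneg.2 h),
        sq_nonneg (u - 0.325), mul_nonneg (mul_nonneg (sub_nonneg.2 hu) (sub_nonneg.2 h))
          (sq_nonneg u)]
    linarith
  · let f : ℝ → ℝ := fun u => (2 - u) ^ 3 + 3 * Real.log u
    have hd : ∀ x : ℝ, 0 < x → HasDerivAt f (3 * (2 - x) ^ 2 * (-1) + 3 * x⁻¹) x := by
      intro x hx
      have h1 : HasDerivAt (fun u : ℝ => (2 - u) ^ 3) (3 * (2 - x) ^ 2 * (-1)) x := by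
        have := ((hasDerivAt_id x).const_sub 2).fun_pow 3
        simpa using this
      exact h1.add ((Real.hasDerivAt_log hx.ne').const_mul 3)
    have hanti : AntitoneOn f (Set.Icc (2 / 5) 1) := by
      apply antitoneOn_of_deriv_nonpos (convex_Icc _ _)
      · exact fun x hx => (hd x (by linarith [hx.1])).continuousAt.continuousWithinAt
      · exact fun x hx =>
          (hd x (by rw [interior_Icc] at hx; linarith [hx.1])).differentiableAt.differentiableWithinAt
      · intro x hx
        rw [interior_Icc] at hx
        have hx0 : 0 < x := by linarith [hx.1]
        rw [(hd x hx0).deriv]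
        have : x⁻¹ ≤ (2 - x) ^ 2 := by
          rw [inv_le_iff_one_le_mul₀ hx0]
          have h3 : 0 ≤ 3 * x - 1 - x ^ 2 := by nlinarith [hx.1, hx.2]
          nlinarith [mul_nonneg (sub_nonneg.2 hx.2.le) h3]
        linarith
    have := hanti (a := u) (b := 1) ⟨h.le, hu1⟩ ⟨by norm_num, le_rfl⟩ hu1
    simp only [f, Real.log_one] at this
    linarith

/-- The function `u ↦ (2 - u) ^ k` lies above its tangent at `u = 1` taken in the variable
`log u`, except for `u` close to `0`. -/
theorem one_sub_mul_log_le_two_sub_pow {k : ℕ} (hk : 3 ≤ k) {u : ℝ} (hu : 1 / 4 ≤ u)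
    (hu2 : u ≤ 2) : 1 - k * Real.log u ≤ (2 - u) ^ k := by
  have hu0 : 0 < u := by linarith
  have hlog := Real.one_sub_inv_le_log_of_pos hu0
  have hinv : u⁻¹ * u = 1 := inv_mul_cancel₀ hu0.ne'
  induction k, hk using Nat.le_induction with
  | base =>
    rcases le_or_gt u 1 with h | h
    · exact_mod_cast one_sub_three_mul_log_le hu h
    · have h1 := Real.le_log_one_add_of_nonneg (x := u - 1) (by linarith)
      have h2 : u - 1 - (u - 1) ^ 2 / 2 ≤ 2 * (u - 1) / (u - 1 + 2) := by
        rw [le_div_iff₀ (by linarith)]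
        nlinarith [mul_nonneg (sub_nonneg.2 h.le) (sq_nonneg (u - 1))]
      rw [show 1 + (u - 1) = u by ring] at h1
      push_cast
      nlinarith [mul_nonneg (sub_nonneg.2 hu2) (sq_nonneg (u - 1)), sq_nonneg (u - 1)]
  | succ k hk ih =>
    push_cast
    have hstep : -Real.log u ≤ (2 - u) ^ k * (1 - u) := by
      rcases le_or_gt u 1 with h | h
      · have h3 : (2 - u) ^ 3 ≤ (2 - u) ^ k := pow_le_pow_right₀ (by linarith) hk
        have h4 : u⁻¹ ≤ (2 - u) ^ 3 := by
          rw [inv_le_iff_one_le_mul₀ hu0]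
          nlinarith [mul_nonneg (sub_nonneg.2 hu) (sub_nonneg.2 h),
            mul_nonneg (mul_nonneg (sub_nonneg.2 hu) (sub_nonneg.2 h)) hu0.le,
            mul_nonneg (mul_nonneg (sub_nonneg.2 hu) (sub_nonneg.2 h)) (sq_nonneg u)]
        calc -Real.log u ≤ u⁻¹ * (1 - u) := by linarith
          _ ≤ _ := mul_le_mul_of_nonneg_right (h4.trans h3) (by linarith)
      · have h3 : (2 - u) ^ k ≤ 2 - u := pow_le_of_le_one (by linarith) (by linarith) (by omega)
        have h4 : 2 - u ≤ u⁻¹ := by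
          rw [← one_div, le_div_iff₀ hu0]; nlinarith [sq_nonneg (u - 1)]
        nlinarith [mul_le_mul_of_nonneg_right (h3.trans h4) (sub_nonneg.2 h.le)]
    calc 1 - (k + 1) * Real.log u = (1 - k * Real.log u) + -Real.log u := by ring
      _ ≤ (2 - u) ^ k + (2 - u) ^ k * (1 - u) := add_le_add ih hstep
      _ = (2 - u) ^ (k + 1) := by ring

/-- The inequality behind the constant `2 ^ k`: if a vertex sends a proportion `x i` of blue edges
to the `i`-th of `k` red cliques, the probability that it extends a random blue transversal plus
the average probability that it extends a random red `k`-subset of a clique is at least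
`2 ^ (1 - k)`, the value at `x i = 1 / 2`. Both sides are multiplied by `2 ^ k`. -/
theorem two_le_prod_add_sum_pow {k : ℕ} (hk : 3 ≤ k) (x : Fin k → ℝ) (h0 : ∀ i, 0 ≤ x i)
    (h1 : ∀ i, x i ≤ 1) :
    2 ≤ 2 ^ k * (∏ i, x i + (1 / k) * ∑ i, (1 - x i) ^ k) := by
  have hk0 : (0 : ℝ) < k := by exact_mod_cast (by omega : 0 < k)
  have hprod : 0 ≤ ∏ i, x i := Finset.prod_nonneg fun i _ => h0 i
  by_cases hsmall : ∃ i, x i < 1 / 8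
  · obtain ⟨i, hi⟩ := hsmall
    rcases Nat.lt_or_ge k 4 with h | h
    · obtain rfl : k = 3 := by omega
      have key : ∀ a b c : ℝ, 0 ≤ a → 0 ≤ b → 0 ≤ c → b ≤ 1 → c ≤ 1 → a ≤ 1 / 8 →
          1 / 4 ≤ a * b * c + (1 / 3) * ((1 - a) ^ 3 + (1 - b) ^ 3 + (1 - c) ^ 3) := by
        intro a b c ha hb hc hb1 hc1 h
        have hb3 : 0 ≤ (1 - b) ^ 3 := pow_nonneg (by linarith) 3
        have hc3 : 0 ≤ (1 - c) ^ 3 := pow_nonneg (by linarith) 3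
        have habc : 0 ≤ a * b * c := by positivity
        have ha3 : (7 / 8 : ℝ) ^ 3 ≤ (1 - a) ^ 3 := pow_le_pow_left₀ (by norm_num) (by linarith) 3
        rcases le_or_gt b (1 / 2) with hb2 | hb2
        · have : (1 / 2 : ℝ) ^ 3 ≤ (1 - b) ^ 3 := pow_le_pow_left₀ (by norm_num) (by linarith) 3
          linarith
        rcases le_or_gt c (1 / 2) with hc2 | hc2
        · have : (1 / 2 : ℝ) ^ 3 ≤ (1 - c) ^ 3 := pow_le_pow_left₀ (by norm_num) (by linarith) 3
          linarith
        have h4 : a * (1 / 4) ≤ a * b * c := by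
          rw [mul_assoc]
          exact mul_le_mul_of_nonneg_left (by nlinarith) ha
        nlinarith [sq_nonneg a, mul_nonneg ha (sub_nonneg.2 h),
          mul_nonneg (mul_nonneg ha (sub_nonneg.2 h)) ha]
      have h8 : (1 : ℝ) / 4 ≤ ∏ i, x i + (1 / 3) * ∑ i, (1 - x i) ^ 3 := by
        rw [Fin.prod_univ_three, Fin.sum_univ_three]
        fin_cases i
        · exact key _ _ _ (h0 0) (h0 1) (h0 2) (h1 1) (h1 2) hi.le
        · have := key _ _ _ (h0 1) (h0 0) (h0 2) (h1 0) (h1 2) hi.le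
          linarith
        · have := key _ _ _ (h0 2) (h0 0) (h0 1) (h1 0) (h1 1) hi.le
          linarith
      push_cast at *
      linarith
    · have h2 : (7 / 8 : ℝ) ^ k ≤ ∑ i, (1 - x i) ^ k :=
        (pow_le_pow_left₀ (by norm_num) (by linarith) k).trans
          (Finset.single_le_sum (f := fun i => (1 - x i) ^ k)
            (fun j _ => pow_nonneg (by linarith [h1 j]) k) (Finset.mem_univ i))
      have h3 : ∀ j : ℕ, 4 ≤ j → 2 * (j : ℝ) ≤ (7 / 4) ^ j := by
        intro j hj
        induction j, hj using Nat.le_induction with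
        | base => norm_num
        | succ j hj ih =>
          have : (4 : ℝ) ≤ j := by exact_mod_cast hj
          push_cast; rw [pow_succ]; linarith
      calc (2 : ℝ) ≤ (1 / k) * (7 / 4) ^ k := by
            rw [one_div, ← div_eq_inv_mul, le_div_iff₀ hk0]; exact h3 k h
        _ = 2 ^ k * (0 + (1 / k) * (7 / 8) ^ k) := by
            rw [show (7 / 4 : ℝ) = 2 * (7 / 8) by norm_num, mul_pow]; ring
        _ ≤ _ := by gcongr
  · push Not at hsmall
    have hu : ∀ i, 0 < 2 * x i := fun i => by linarith [hsmall i]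
    have hA : 1 + ∑ i, Real.log (2 * x i) ≤ 2 ^ k * ∏ i, x i := by
      have h2 := Real.add_one_le_exp (∑ i, Real.log (2 * x i))
      rw [Real.exp_sum, Finset.prod_congr rfl fun i _ => Real.exp_log (hu i),
        Finset.prod_mul_distrib] at h2
      simp only [Finset.prod_const, Finset.card_univ, Fintype.card_fin] at h2
      linarith
    have hB : k - k * ∑ i, Real.log (2 * x i) ≤ 2 ^ k * ∑ i, (1 - x i) ^ k := by
      calc k - k * ∑ i, Real.log (2 * x i) = ∑ i : Fin k, (1 - k * Real.log (2 * x i)) := by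
            simp [Finset.mul_sum]
        _ ≤ ∑ i, (2 - 2 * x i) ^ k := Finset.sum_le_sum fun i _ =>
            one_sub_mul_log_le_two_sub_pow hk (by linarith [hsmall i]) (by linarith [h1 i])
        _ = _ := by
            rw [Finset.mul_sum]
            refine Finset.sum_congr rfl fun i _ => ?_
            rw [← mul_pow]; ring
    have hC := mul_le_mul_of_nonneg_left hB (one_div_nonneg.2 hk0.le)
    have hD : (1 / k : ℝ) * (k - k * ∑ i, Real.log (2 * x i)) = 1 - ∑ i, Real.log (2 * x i) := by
      field_simp
    linarith

/-! ### Monochromatic cliques -/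

/-- A graph on a set of at least `2 ^ (a + b)` vertices has a clique of order `a` or an independent
set of order `b`. -/
theorem exists_isNClique_or_compl {V : Type*} [DecidableEq V] (G : SimpleGraph V) :
    ∀ (m a b : ℕ), a + b = m → ∀ S : Finset V, 2 ^ m ≤ S.card →
      ∃ T ⊆ S, G.IsNClique a T ∨ Gᶜ.IsNClique b T := by
  classical
  intro m
  induction m with
  | zero =>
    intro a b hab S _
    exact ⟨∅, by simp, Or.inl (by simp [show a = 0 by omega])⟩
  | succ m ih =>
    intro a b hab S hS
    rcases Nat.eq_zero_or_pos a with rfl | ha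
    · exact ⟨∅, by simp, Or.inl (by simp)⟩
    rcases Nat.eq_zero_or_pos b with rfl | hb
    · exact ⟨∅, by simp, Or.inr (by simp)⟩
    obtain ⟨v, hv⟩ : S.Nonempty := Finset.card_pos.mp (lt_of_lt_of_le (by positivity) hS)
    have hcard : ((S.erase v).filter (fun w => G.Adj v w)).card
        + ((S.erase v).filter (fun w => ¬ G.Adj v w)).card = S.card - 1 := by
      rw [Finset.card_filter_add_card_filter_not, Finset.card_erase_of_mem hv]
    rw [pow_succ] at hS
    rcases le_or_gt (2 ^ m) ((S.erase v).filter (fun w => G.Adj v w)).card with h | h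
    · obtain ⟨T, hT, hc⟩ := ih (a - 1) b (by omega) _ h
      have hTS : T ⊆ S := fun w hw => Finset.mem_of_mem_erase (Finset.mem_filter.mp (hT hw)).1
      rcases hc with hc | hc
      · refine ⟨insert v T, Finset.insert_subset hv hTS, Or.inl ?_⟩
        have := hc.insert (a := v) fun w hw => (Finset.mem_filter.mp (hT hw)).2
        rwa [Nat.sub_add_cancel ha] at this
      · exact ⟨T, hTS, Or.inr hc⟩
    · obtain ⟨T, hT, hc⟩ := ih a (b - 1) (by omega)
        ((S.erase v).filter (fun w => ¬ G.Adj v w)) (by omega)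
      have hTS : T ⊆ S := fun w hw => Finset.mem_of_mem_erase (Finset.mem_filter.mp (hT hw)).1
      rcases hc with hc | hc
      · exact ⟨T, hTS, Or.inl hc⟩
      · refine ⟨insert v T, Finset.insert_subset hv hTS, Or.inr ?_⟩
        have := hc.insert (a := v) fun w hw => by
          have hw' := Finset.mem_filter.mp (hT hw)
          exact (SimpleGraph.compl_adj _ _ _).mpr ⟨(Finset.ne_of_mem_erase hw'.1).symm, hw'.2⟩
        rwa [Nat.sub_add_cancel hb] at this

/-- Two graphs, indexed by the colors, that partition the edges of the complete graph. -/
def IsColoring {V : Type*} (G : Bool → SimpleGraph V) : Prop :=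
  ∀ c : Bool, ∀ u v : V, u ≠ v → ((G !c).Adj u v ↔ ¬ (G c).Adj u v)

/-- No monochromatic book with `k` spine vertices and `n` pages: every monochromatic clique of
order `k`, given as an injective tuple, has fewer than `n` common neighbors in its color. -/
def BookFree {V : Type*} [Fintype V] (G : Bool → SimpleGraph V) (k n : ℕ) : Prop :=
  ∀ (c : Bool) (f : Fin k → V), (∀ i j, i ≠ j → (G c).Adj (f i) (f j)) →
    {v | ∀ i, (G c).Adj v (f i)}.ncard < n

open Classical in
/-- The neighbors of `v` inside `F`, in the color `c`. -/
noncomputable def nbrs {V : Type*} (G : Bool → SimpleGraph V) (c : Bool) (v : V) (F : Finset V) :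
    Finset V :=
  F.filter fun u => (G c).Adj v u

theorem mem_nbrs {V : Type*} {G : Bool → SimpleGraph V} {c : Bool} {u v : V} {F : Finset V} :
    u ∈ nbrs G c v F ↔ u ∈ F ∧ (G c).Adj v u := by
  simp [nbrs]

theorem IsColoring.card_nbrs_add {V : Type*} [DecidableEq V] {G : Bool → SimpleGraph V}
    (hG : IsColoring G) (c : Bool) (v : V) (F : Finset V) :
    (nbrs G c v F).card + (nbrs G (!c) v F).card = (F.erase v).card := by
  classical
  rw [← Finset.card_filter_add_card_filter_not (s := F.erase v) (fun u => (G c).Adj v u)]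
  congr 2
  · ext u
    simp only [mem_nbrs, Finset.mem_filter, Finset.mem_erase]
    exact ⟨fun h => ⟨⟨h.2.ne', h.1⟩, h.2⟩, fun h => ⟨h.1.2, h.2⟩⟩
  · ext u
    simp only [mem_nbrs, Finset.mem_filter, Finset.mem_erase]
    constructor
    · exact fun h => ⟨⟨h.2.ne', h.1⟩, (hG c v u h.2.ne).1 h.2⟩
    · exact fun h => ⟨h.1.2, (hG c v u h.1.1.symm).2 h.2⟩

/-- Double counting of the pairs of a vertex and a tuple in its neighborhood. -/
theorem sum_prod_card_nbrs {V : Type*} [Fintype V] [DecidableEq V] (G : Bool → SimpleGraph V)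
    (c : Bool) {k : ℕ} (F : Fin k → Finset V) :
    ∑ v, ∏ i, (nbrs G c v (F i)).card =
      ∑ f ∈ Fintype.piFinset F, {v | ∀ i, (G c).Adj v (f i)}.ncard := by
  classical
  have h1 : ∀ v, ∏ i, (nbrs G c v (F i)).card =
      ((Fintype.piFinset F).filter fun f => ∀ i, (G c).Adj v (f i)).card := by
    intro v
    rw [← Fintype.card_piFinset]
    congr 1
    ext f
    simp only [Fintype.mem_piFinset, mem_nbrs, Finset.mem_filter, forall_and]
  have h2 : ∀ f : Fin k → V, {v | ∀ i, (G c).Adj v (f i)}.ncard =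
      (Finset.univ.filter fun v => ∀ i, (G c).Adj v (f i)).card := by
    intro f
    rw [← Set.ncard_coe_finset]
    congr 1
    ext v; simp
  rw [Finset.sum_congr rfl fun v _ => h1 v, Finset.sum_congr rfl fun f _ => h2 f]
  exact Finset.sum_card_bipartiteAbove_eq_sum_card_bipartiteBelow _

/-- At most `k ^ 2 * s ^ (k - 1)` of the `k`-tuples in a set of `s` elements repeat an element. -/
theorem card_filter_not_injective_le {V : Type*} [DecidableEq V] (k : ℕ) (F : Finset V) :
    ((Fintype.piFinset fun _ : Fin k => F).filter fun f => ¬ Function.Injective f).card ≤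
      k ^ 2 * F.card ^ (k - 1) := by
  classical
  have hsub : ((Fintype.piFinset fun _ : Fin k => F).filter fun f => ¬ Function.Injective f) ⊆
      (Finset.univ : Finset (Fin k × Fin k)).biUnion fun p =>
        (Fintype.piFinset fun _ : Fin k => F).filter fun f => p.1 ≠ p.2 ∧ f p.1 = f p.2 := by
    intro f hf
    rw [Finset.mem_filter, Function.Injective] at hf
    push Not at hf
    obtain ⟨hf, i, j, hij, hne⟩ := hf
    simp only [Finset.mem_biUnion, Finset.mem_univ, true_and, Finset.mem_filter]
    exact ⟨(i, j), hf, hne, hij⟩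
  refine (Finset.card_le_card hsub).trans (Finset.card_biUnion_le.trans ?_)
  refine (Finset.sum_le_card_nsmul _ _ (F.card ^ (k - 1)) fun p _ => ?_).trans
    (by simp [sq])
  obtain ⟨i, j⟩ := p
  rcases eq_or_ne i j with rfl | hij
  · simp
  -- A tuple with `f i = f j` is determined by its entries other than the `j`-th.
  have hcard : (Fintype.piFinset fun _ : {l : Fin k // l ≠ j} => F).card = F.card ^ (k - 1) := by
    simp [Fintype.card_piFinset, Fintype.card_subtype_compl]
  rw [← hcard]
  refine Finset.card_le_card_of_injOn (fun f l => f l) ?_ ?_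
  · intro f hf
    simp only [Finset.coe_filter, Fintype.mem_piFinset, Set.mem_ofPred_eq] at hf
    simp only [Finset.mem_coe, Fintype.mem_piFinset]
    exact fun l => hf.1 l
  · intro f hf g hg hfg
    simp only [Finset.coe_filter, Fintype.mem_piFinset, Set.mem_ofPred_eq] at hf hg
    have h : ∀ l, l ≠ j → f l = g l := fun l hl => congrFun hfg ⟨l, hl⟩
    funext l
    rcases eq_or_ne l j with rfl | hl
    · rw [← hf.2.2, ← hg.2.2]; exact h i hij
    · exact h l hl

/-- A moment bound for the degrees to a monochromatic clique, in its own color: an injective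
`k`-tuple in the clique has fewer than `n` common neighbors, and few tuples are not injective. -/
theorem BookFree.sum_card_nbrs_pow_le {V : Type*} [Fintype V] [DecidableEq V]
    {G : Bool → SimpleGraph V} {k n : ℕ} (hb : BookFree G k n) {c : Bool} {F : Finset V}
    (hF : (G c).IsClique F) :
    ∑ v, (nbrs G c v F).card ^ k ≤
      F.card ^ k * n + k ^ 2 * F.card ^ (k - 1) * Fintype.card V := by
  classical
  have h := sum_prod_card_nbrs G c (fun _ : Fin k => F)
  simp only [Finset.prod_const, Finset.card_univ, Fintype.card_fin] at h
  rw [h, ← Finset.sum_filter_add_sum_filter_not _ (fun f : Fin k → V => Function.Injective f)]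
  refine add_le_add ?_ ?_
  · refine (Finset.sum_le_card_nsmul _ _ n fun f hf => ?_).trans ?_
    · simp only [Finset.mem_filter, Fintype.mem_piFinset] at hf
      exact (hb c f fun i j hij => hF (hf.1 i) (hf.1 j) fun e => hij (hf.2 e)).le
    · rw [smul_eq_mul]
      exact Nat.mul_le_mul_right _ ((Finset.card_filter_le _ _).trans
        (by simp [Fintype.card_piFinset]))
  · refine (Finset.sum_le_card_nsmul _ _ (Fintype.card V) fun f _ => ?_).trans ?_
    · rw [← Nat.card_eq_fintype_card]; exact Set.ncard_le_card _
    · rw [smul_eq_mul]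
      exact Nat.mul_le_mul_right _ (card_filter_not_injective_le k F)

/-- `k` cliques of color `c`, any two of them joined completely in the other color. -/
structure IsMultipartite {V : Type*} (G : Bool → SimpleGraph V) (c : Bool) (k s : ℕ)
    (F : ℕ → Finset V) : Prop where
  card_eq : ∀ i < k, (F i).card = s
  isClique : ∀ i < k, (G c).IsClique (F i : Set V)
  adj : ∀ i < k, ∀ j < k, i ≠ j → ∀ u ∈ F i, ∀ v ∈ F j, (G !c).Adj u v

theorem BookFree.sum_prod_card_nbrs_le {V : Type*} [Fintype V] [DecidableEq V]
    {G : Bool → SimpleGraph V} {k n s : ℕ} (hb : BookFree G k n) {c : Bool} {F : ℕ → Finset V}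
    (hF : IsMultipartite G c k s F) :
    ∑ v, ∏ i : Fin k, (nbrs G (!c) v (F i)).card ≤ s ^ k * n := by
  rw [sum_prod_card_nbrs G (!c) (fun i : Fin k => F i)]
  refine (Finset.sum_le_card_nsmul _ _ n fun f hf => ?_).trans ?_
  · rw [Fintype.mem_piFinset] at hf
    exact (hb (!c) f fun i j hij =>
      hF.adj i i.2 j j.2 (fun e => hij (Fin.ext e)) _ (hf i) _ (hf j)).le
  · rw [smul_eq_mul, Fintype.card_piFinset,
      Finset.prod_congr rfl fun i _ => hF.card_eq i.1 i.2]
    simp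

/-- The double count that gives the constant `2 ^ k`: in a book-free coloring with `k` cliques of
one color joined completely in the other color, both the transversals and the `k`-subsets of the
cliques are monochromatic cliques with fewer than `n` common neighbors. -/
theorem BookFree.card_mul_two_le {V : Type*} [Fintype V] [DecidableEq V]
    {G : Bool → SimpleGraph V} {k n s : ℕ} (hG : IsColoring G) (hb : BookFree G k n) (hk : 3 ≤ k)
    (hs : 0 < s) {c : Bool} {F : ℕ → Finset V} (hF : IsMultipartite G c k s F) :
    ((Fintype.card V : ℝ) - k * s) * 2 ≤
      2 ^ k * (2 * n + k ^ 2 * Fintype.card V / s) := by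
  classical
  have hk0 : (0 : ℝ) < k := by exact_mod_cast (by omega : 0 < k)
  have hs0 : (0 : ℝ) < s := by exact_mod_cast hs
  set N : ℝ := (Fintype.card V : ℝ) with hN
  let x : V → Fin k → ℝ := fun v i => (nbrs G (!c) v (F i)).card / s
  let y : V → Fin k → ℝ := fun v i => (nbrs G c v (F i)).card / s
  let Φ : V → ℝ := fun v => ∏ i, x v i + (1 / k) * ∑ i, y v i ^ k
  have hx0 : ∀ v i, 0 ≤ x v i := fun v i => div_nonneg (Nat.cast_nonneg _) hs0.le
  have hy0 : ∀ v i, 0 ≤ y v i := fun v i => div_nonneg (Nat.cast_nonneg _) hs0.le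
  have hΦ0 : ∀ v, 0 ≤ Φ v := fun v => add_nonneg (Finset.prod_nonneg fun i _ => hx0 v i)
    (mul_nonneg (one_div_nonneg.2 hk0.le) (Finset.sum_nonneg fun i _ => pow_nonneg (hy0 v i) k))
  let U : Finset V := Finset.univ.biUnion fun i : Fin k => F i
  have hU : (U.card : ℝ) ≤ k * s := by
    have : U.card ≤ ∑ i : Fin k, (F i).card := Finset.card_biUnion_le
    rw [Finset.sum_congr rfl fun i _ => hF.card_eq i.1 i.2] at this
    simp only [Finset.sum_const, Finset.card_univ, Fintype.card_fin, smul_eq_mul] at this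
    exact_mod_cast this
  have hlow : ∀ v ∈ Uᶜ, 2 / 2 ^ k ≤ Φ v := by
    intro v hv
    have hv' : ∀ i : Fin k, v ∉ F i := fun i hi =>
      (Finset.mem_compl.1 hv) (Finset.mem_biUnion.2 ⟨i, Finset.mem_univ _, hi⟩)
    have hxy : ∀ i, y v i = 1 - x v i := by
      intro i
      have h := hG.card_nbrs_add c v (F i)
      rw [Finset.erase_eq_of_notMem (hv' i), hF.card_eq i i.2] at h
      have h' : ((nbrs G c v (F i)).card : ℝ) + (nbrs G (!c) v (F i)).card = s := by
        exact_mod_cast h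
      simp only [x, y]
      field_simp
      linarith
    have h := two_le_prod_add_sum_pow hk (x v) (hx0 v) (fun i => by linarith [hxy i, hy0 v i])
    rw [div_le_iff₀ (by positivity), mul_comm]
    simp only [Φ, hxy]
    exact h
  have hsum : (N - k * s) * (2 / 2 ^ k) ≤ ∑ v, Φ v := by
    calc (N - k * s) * (2 / 2 ^ k) ≤ (Uᶜ.card : ℝ) * (2 / 2 ^ k) := by
          have hc : (U.card : ℝ) + Uᶜ.card = N := by
            rw [hN]; exact_mod_cast Finset.card_add_card_compl U
          gcongr
          linarith
      _ = ∑ v ∈ Uᶜ, (2 / 2 ^ k : ℝ) := by simp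
      _ ≤ ∑ v ∈ Uᶜ, Φ v := Finset.sum_le_sum hlow
      _ ≤ ∑ v, Φ v := Finset.sum_le_sum_of_subset_of_nonneg (Finset.subset_univ _)
          fun v _ _ => hΦ0 v
  have hprod : ∑ v, ∏ i, x v i ≤ n := by
    have h : (∑ v, ∏ i : Fin k, ((nbrs G (!c) v (F i)).card : ℝ)) ≤ s ^ k * n := by
      exact_mod_cast hb.sum_prod_card_nbrs_le hF
    simp only [x, Finset.prod_div_distrib, Finset.prod_const, Finset.card_univ, Fintype.card_fin]
    rw [← Finset.sum_div, div_le_iff₀ (by positivity)]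
    linarith
  have hpow : ∀ i : Fin k, ∑ v, y v i ^ k ≤ n + k ^ 2 * N / s := by
    intro i
    have h : (∑ v, ((nbrs G c v (F i)).card : ℝ) ^ k) ≤
        s ^ k * n + k ^ 2 * s ^ (k - 1) * N := by
      have := hb.sum_card_nbrs_pow_le (hF.isClique i i.2)
      rw [hF.card_eq i i.2] at this
      rw [hN]; exact_mod_cast this
    simp only [y, div_pow]
    rw [← Finset.sum_div, div_le_iff₀ (by positivity)]
    refine h.trans (le_of_eq ?_)
    obtain ⟨m, rfl⟩ : ∃ m, k = m + 1 := ⟨k - 1, by omega⟩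
    simp only [Nat.add_sub_cancel]
    field_simp
    ring
  have hΦ : ∑ v, Φ v ≤ 2 * n + k ^ 2 * N / s := by
    simp only [Φ]
    rw [Finset.sum_add_distrib, ← Finset.mul_sum, Finset.sum_comm]
    have : ∑ i : Fin k, ∑ v, y v i ^ k ≤ k * (n + k ^ 2 * N / s) :=
      (Finset.sum_le_sum fun i _ => hpow i).trans (by simp [mul_add])
    have h2 := mul_le_mul_of_nonneg_left this (one_div_nonneg.2 hk0.le)
    rw [← mul_assoc, one_div_mul_cancel hk0.ne', one_mul] at h2
    linarith
  have h := hsum.trans hΦ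
  rw [mul_div_assoc', div_le_iff₀ (by positivity)] at h
  linarith

/-! ### Finding cliques of one color joined completely in the other color -/

theorem IsMultipartite.mono {V : Type*} {G : Bool → SimpleGraph V} {c : Bool} {k l s : ℕ}
    {F : ℕ → Finset V} (hF : IsMultipartite G c k s F) (hl : l ≤ k) : IsMultipartite G c l s F :=
  ⟨fun i hi => hF.card_eq i (by omega), fun i hi => hF.isClique i (by omega),
    fun i hi j hj => hF.adj i (by omega) j (by omega)⟩

theorem IsMultipartite.of_subset {V : Type*} {G : Bool → SimpleGraph V} {c : Bool} {k s t : ℕ}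
    {F F' : ℕ → Finset V} (hF : IsMultipartite G c k s F) (hsub : ∀ i < k, F' i ⊆ F i)
    (hcard : ∀ i < k, (F' i).card = t) : IsMultipartite G c k t F' :=
  ⟨hcard, fun i hi => (hF.isClique i hi).subset (by exact_mod_cast hsub i hi),
    fun i hi j hj hij u hu v hv => hF.adj i hi j hj hij u (hsub i hi hu) v (hsub j hj hv)⟩

theorem IsMultipartite.exists_trim {V : Type*} {G : Bool → SimpleGraph V} {c : Bool} {k s t : ℕ}
    {F : ℕ → Finset V} (hF : IsMultipartite G c k s F) (hts : t ≤ s) :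
    ∃ F', IsMultipartite G c k t F' := by
  have h : ∀ i, ∃ A : Finset V, i < k → A ⊆ F i ∧ A.card = t := by
    intro i
    by_cases hi : i < k
    · obtain ⟨A, hA, hc⟩ := Finset.exists_subset_card_eq (s := F i) (n := t)
        (by rw [hF.card_eq i hi]; exact hts)
      exact ⟨A, fun _ => ⟨hA, hc⟩⟩
    · exact ⟨∅, fun h => absurd h hi⟩
  choose F' hF' using h
  exact ⟨F', hF.of_subset (fun i hi => (hF' i hi).1) fun i hi => (hF' i hi).2⟩

theorem IsMultipartite.snoc {V : Type*} {G : Bool → SimpleGraph V} {c : Bool} {k t : ℕ}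
    {F : ℕ → Finset V} (hF : IsMultipartite G c k t F) {Q : Finset V} (hQ : (G c).IsNClique t Q)
    (hadj : ∀ i < k, ∀ u ∈ F i, ∀ v ∈ Q, (G !c).Adj u v) :
    IsMultipartite G c (k + 1) t (fun i => if i < k then F i else Q) := by
  refine ⟨fun i hi => ?_, fun i hi => ?_, fun i hi j hj hij u hu v hv => ?_⟩
  · split_ifs with h
    · exact hF.card_eq i h
    · exact hQ.card_eq
  · split_ifs with h
    · exact hF.isClique i h
    · exact hQ.isClique
  · split_ifs at hu hv with h1 h2 h2
    · exact hF.adj i h1 j h2 hij u hu v hv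
    · exact hadj i h1 u hu v hv
    · exact (hadj j h2 v hv u hu).symm
    · omega

/-- In a book-free coloring, few vertices have small degree to a monochromatic clique in the color
that the clique does not use. -/
theorem BookFree.card_small_degree_le {V : Type*} [Fintype V] [DecidableEq V]
    {G : Bool → SimpleGraph V} {k n t : ℕ} (hG : IsColoring G) (hb : BookFree G k n) (hk : 1 ≤ k)
    (ht : 1 ≤ t) {c : Bool} {F : Finset V} (hF : (G c).IsNClique (4 * k * t) F) :
    ((Finset.univ.filter fun v => (nbrs G (!c) v F).card < t).card : ℝ) ≤
      4 / 3 * (n + k / (4 * t) * Fintype.card V) := by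
  set B := Finset.univ.filter fun v => (nbrs G (!c) v F).card < t
  have hk0 : (0 : ℝ) < k := by exact_mod_cast hk
  have ht0 : (0 : ℝ) < t := by exact_mod_cast ht
  have hdeg : ∀ v ∈ B, 3 / 4 * (4 * k * t : ℝ) ^ k ≤ ((nbrs G c v F).card : ℝ) ^ k := by
    intro v hv
    have h1 : (nbrs G (!c) v F).card < t := (Finset.mem_filter.1 hv).2
    have h2 := hG.card_nbrs_add c v F
    have h3 : F.card - 1 ≤ (F.erase v).card := Finset.pred_card_le_card_erase
    rw [hF.card_eq] at h3
    have h4 : 4 * k * t ≤ (nbrs G c v F).card + t := by omega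
    have h5 : (4 * k * t : ℝ) * (1 + -(1 / (4 * k))) ≤ (nbrs G c v F).card := by
      have h6 : (4 * k * t : ℝ) ≤ (nbrs G c v F).card + t := by exact_mod_cast h4
      have h7 : (4 * k * t : ℝ) * (1 + -(1 / (4 * k))) = 4 * k * t - t := by field_simp; ring
      linarith
    have h8 : -2 ≤ -(1 / (4 * k : ℝ)) := by
      have : (1 : ℝ) ≤ k := by exact_mod_cast hk
      have : 1 / (4 * k : ℝ) ≤ 1 := by rw [div_le_one (by positivity)]; linarith
      linarith
    have h9 := one_add_mul_le_pow h8 k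
    have h10 : (1 : ℝ) + k * -(1 / (4 * k)) = 3 / 4 := by field_simp; ring
    rw [h10] at h9
    have h11 : 0 ≤ (4 * k * t : ℝ) * (1 + -(1 / (4 * k))) := by
      have h7 : (4 * k * t : ℝ) * (1 + -(1 / (4 * k))) = (4 * k - 1) * t := by field_simp; ring
      rw [h7]
      have : (1 : ℝ) ≤ k := by exact_mod_cast hk
      exact mul_nonneg (by linarith) ht0.le
    calc 3 / 4 * (4 * k * t : ℝ) ^ k ≤ (1 + -(1 / (4 * k : ℝ))) ^ k * (4 * k * t : ℝ) ^ k := by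
          gcongr
      _ = ((4 * k * t : ℝ) * (1 + -(1 / (4 * k)))) ^ k := by
          rw [mul_pow _ (1 + -(1 / (4 * (k : ℝ)))), mul_comm]
      _ ≤ _ := pow_le_pow_left₀ h11 h5 k
  have hsum : (B.card : ℝ) * (3 / 4 * (4 * k * t : ℝ) ^ k) ≤
      (4 * k * t : ℝ) ^ k * n + k ^ 2 * (4 * k * t : ℝ) ^ (k - 1) * Fintype.card V := by
    calc (B.card : ℝ) * (3 / 4 * (4 * k * t : ℝ) ^ k)
        = ∑ v ∈ B, (3 / 4 * (4 * k * t : ℝ) ^ k) := by simp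
      _ ≤ ∑ v ∈ B, ((nbrs G c v F).card : ℝ) ^ k := Finset.sum_le_sum hdeg
      _ ≤ ∑ v, ((nbrs G c v F).card : ℝ) ^ k :=
          Finset.sum_le_sum_of_subset_of_nonneg (Finset.subset_univ _) fun v _ _ => by positivity
      _ ≤ _ := by
          have := hb.sum_card_nbrs_pow_le hF.isClique
          rw [hF.card_eq] at this
          exact_mod_cast this
  have hpos : (0 : ℝ) < (4 * k * t : ℝ) ^ k := by positivity
  have heq : (4 * k * t : ℝ) ^ k * n + k ^ 2 * (4 * k * t : ℝ) ^ (k - 1) * Fintype.card V =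
      (4 / 3 * (n + k / (4 * t) * Fintype.card V)) * (3 / 4 * (4 * k * t : ℝ) ^ k) := by
    obtain ⟨m, rfl⟩ : ∃ m, k = m + 1 := ⟨k - 1, by omega⟩
    rw [Nat.add_sub_cancel, pow_succ (4 * ((m + 1 : ℕ) : ℝ) * t) m]
    field_simp
  rw [heq] at hsum
  exact le_of_mul_le_mul_right hsum (by positivity)

/-- One step of the construction: given fewer than `k` red cliques that are pairwise blue-complete,
and fewer than `k` blue cliques that are pairwise red-complete, one of the two systems can be
shrunk and extended by one more clique. -/
theorem BookFree.exists_isMultipartite_succ {V : Type*} [Fintype V] [DecidableEq V]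
    {G : Bool → SimpleGraph V} {k n t : ℕ} (hG : IsColoring G) (hb : BookFree G k n) (hk : 3 ≤ k)
    (ht : 4 * k ^ 2 ≤ t) (hn : 2 ^ k * n ≤ Fintype.card V)
    (hV : 6 * (2 ^ (2 * k * (4 * k * t)) * 2 ^ (t + t)) ≤ Fintype.card V)
    {a : Bool → ℕ} {F : Bool → ℕ → Finset V} (ha : ∀ c, a c < k)
    (hF : ∀ c, IsMultipartite G c (a c) (4 * k * t) (F c)) :
    ∃ c F', IsMultipartite G c (a c + 1) t F' := by
  classical
  have ht1 : 1 ≤ t := by nlinarith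
  have hk0 : (0 : ℝ) < k := by exact_mod_cast (by omega : 0 < k)
  have ht0 : (0 : ℝ) < t := by exact_mod_cast ht1
  set N : ℝ := (Fintype.card V : ℝ) with hN
  have hN0 : 0 ≤ N := Nat.cast_nonneg _
  let U : Finset V := Finset.univ.biUnion fun c => (Finset.range (a c)).biUnion (F c)
  let B : Bool → ℕ → Finset V := fun c i =>
    Finset.univ.filter fun v => (nbrs G (!c) v (F c i)).card < t
  let W : Finset V := Finset.univ.filter fun v =>
    ∀ c, ∀ i < a c, t ≤ (nbrs G (!c) v (F c i)).card
  have hUcard : U.card ≤ 2 * k * (4 * k * t) := by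
    calc U.card ≤ ∑ c, ∑ i ∈ Finset.range (a c), (F c i).card :=
          Finset.card_biUnion_le.trans (Finset.sum_le_sum fun c _ => Finset.card_biUnion_le)
      _ ≤ ∑ c : Bool, k * (4 * k * t) := by
          refine Finset.sum_le_sum fun c _ => ?_
          rw [Finset.sum_congr rfl fun i hi => (hF c).card_eq i (Finset.mem_range.1 hi)]
          simp only [Finset.sum_const, Finset.card_range, smul_eq_mul]
          exact Nat.mul_le_mul_right _ (ha c).le
      _ = 2 * k * (4 * k * t) := by simp; ring
  -- Every clique excludes fewer than about `4 / 3 * N / 2 ^ k` vertices, and there are at most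
  -- `2 * (k - 1)` cliques; for `k ≥ 3` a constant proportion of the vertices is left.
  have hW : N / 6 ≤ W.card := by
    have hBcard : ∀ c, ∀ i < a c, ((B c i).card : ℝ) ≤ 4 / 3 * (N / 2 ^ k + N / (16 * k)) := by
      intro c i hi
      refine (hb.card_small_degree_le hG (by omega) ht1
        ⟨(hF c).isClique i hi, (hF c).card_eq i hi⟩).trans ?_
      have h1 : (n : ℝ) ≤ N / 2 ^ k := by
        rw [le_div_iff₀ (by positivity), mul_comm, hN]; exact_mod_cast hn
      have h2 : (k : ℝ) / (4 * t) ≤ 1 / (16 * k) := by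
        rw [div_le_div_iff₀ (by positivity) (by positivity)]
        have : (4 : ℝ) * k ^ 2 ≤ t := by exact_mod_cast ht
        nlinarith
      have h3 := mul_le_mul_of_nonneg_right h2 hN0
      rw [one_div_mul_eq_div] at h3
      linarith
    have hcover : Wᶜ ⊆ Finset.univ.biUnion fun c => (Finset.range (a c)).biUnion (B c) := by
      intro v hv
      simp only [W, Finset.mem_compl, Finset.mem_filter, Finset.mem_univ, true_and] at hv
      push Not at hv
      obtain ⟨c, i, hi, h⟩ := hv
      simp only [Finset.mem_biUnion, Finset.mem_univ, true_and, Finset.mem_range, B,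
        Finset.mem_filter]
      exact ⟨c, i, hi, h⟩
    set β : ℝ := 4 / 3 * (N / 2 ^ k + N / (16 * k)) with hβ
    have hβ0 : 0 ≤ β := by positivity
    have hWc : (Wᶜ.card : ℝ) ≤ 2 * (k - 1) * β := by
      calc (Wᶜ.card : ℝ) ≤ ∑ c, ∑ i ∈ Finset.range (a c), ((B c i).card : ℝ) := by
            exact_mod_cast (Finset.card_le_card hcover).trans
              (Finset.card_biUnion_le.trans (Finset.sum_le_sum fun c _ => Finset.card_biUnion_le))
        _ ≤ ∑ c : Bool, ((k : ℝ) - 1) * β := by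
            refine Finset.sum_le_sum fun c _ => ?_
            refine (Finset.sum_le_sum fun i hi =>
              hBcard c i (Finset.mem_range.1 hi)).trans ?_
            rw [Finset.sum_const, Finset.card_range, nsmul_eq_mul]
            have : (a c : ℝ) + 1 ≤ k := by exact_mod_cast ha c
            gcongr
            linarith
        _ = _ := by simp; ring
    have hpow : ∀ j : ℕ, 3 ≤ j → 4 * ((j : ℝ) - 1) ≤ 2 ^ j := by
      intro j hj
      induction j, hj using Nat.le_induction with
      | base => norm_num
      | succ j hj ih =>
        have : (3 : ℝ) ≤ j := by exact_mod_cast hj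
        push_cast; rw [pow_succ]; linarith
    have h1 : 2 * ((k : ℝ) - 1) * (N / 2 ^ k) ≤ N / 2 := by
      rw [mul_div_assoc', div_le_div_iff₀ (by positivity) (by norm_num)]
      nlinarith [hpow k hk]
    have h2 : 2 * ((k : ℝ) - 1) * (N / (16 * k)) ≤ N / 8 := by
      rw [mul_div_assoc', div_le_div_iff₀ (by positivity) (by norm_num)]
      nlinarith
    have h3 : (W.card : ℝ) + Wᶜ.card = N := by
      rw [hN]; exact_mod_cast Finset.card_add_card_compl W
    have h4 : 2 * ((k : ℝ) - 1) * β =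
        4 / 3 * (2 * ((k : ℝ) - 1) * (N / 2 ^ k) + 2 * ((k : ℝ) - 1) * (N / (16 * k))) := by
      rw [hβ]; ring
    linarith
  have hWcard : U.powerset.card * 2 ^ (t + t) ≤ W.card := by
    have h1 : Fintype.card V ≤ 6 * W.card := by
      have : N ≤ 6 * (W.card : ℝ) := by linarith
      rw [hN] at this
      exact_mod_cast this
    have h2 : 2 ^ U.card * 2 ^ (t + t) ≤ 2 ^ (2 * k * (4 * k * t)) * 2 ^ (t + t) :=
      Nat.mul_le_mul_right _ (Nat.pow_le_pow_right (by norm_num) hUcard)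
    rw [Finset.card_powerset]
    omega
  -- A vertex of a clique has no neighbors in it in the other color.
  have hWU : ∀ v ∈ W, v ∉ U := by
    intro v hv hvU
    simp only [U, Finset.mem_biUnion, Finset.mem_univ, true_and, Finset.mem_range] at hvU
    obtain ⟨c, i, hi, hvi⟩ := hvU
    have h := (Finset.mem_filter.1 hv).2 c i hi
    have h0 : nbrs G (!c) v (F c i) = ∅ := by
      refine Finset.eq_empty_of_forall_notMem fun u hu => ?_
      rw [mem_nbrs] at hu
      exact (hG c v u hu.2.ne).1 hu.2 ((hF c).isClique i hi hvi hu.1 hu.2.ne)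
    rw [h0, Finset.card_empty] at h
    omega
  obtain ⟨τ, -, hτ⟩ := Finset.exists_le_card_fiber_of_mul_le_card_of_maps_to
    (f := fun v => nbrs G true v U)
    (fun v _ => Finset.mem_powerset.2 fun u hu => (mem_nbrs.1 hu).1)
    (Finset.powerset_nonempty U) hWcard
  obtain ⟨c, Q, hQP, hQ⟩ : ∃ (c : Bool) (Q : Finset V),
      Q ⊆ W.filter (fun v => nbrs G true v U = τ) ∧ (G c).IsNClique t Q := by
    obtain ⟨Q, hQP, hQ | hQ⟩ := exists_isNClique_or_compl (G true) (t + t) t t rfl _ hτ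
    · exact ⟨true, Q, hQP, hQ⟩
    · refine ⟨false, Q, hQP, ⟨fun u hu v hv huv => ?_, hQ.card_eq⟩⟩
      exact (hG true u v huv).2 (((G true).compl_adj u v).1 (hQ.isClique hu hv huv)).2
  have hQW : ∀ v ∈ Q, v ∈ W := fun v hv => (Finset.mem_filter.1 (hQP hv)).1
  have htype : ∀ v ∈ Q, ∀ w ∈ Q, ∀ u ∈ U, (G !c).Adj v u → (G !c).Adj w u := by
    intro v hv w hw u hu h
    have hvu : v ≠ u := fun e => hWU v (hQW v hv) (e ▸ hu)
    have hwu : w ≠ u := fun e => hWU w (hQW w hw) (e ▸ hu)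
    have h1 : u ∈ nbrs G true v U ↔ u ∈ nbrs G true w U := by
      rw [(Finset.mem_filter.1 (hQP hv)).2, (Finset.mem_filter.1 (hQP hw)).2]
    simp only [mem_nbrs, hu, true_and] at h1
    cases c
    · exact h1.1 h
    · exact (hG true w u hwu).2 fun h2 => (hG true v u hvu).1 h (h1.2 h2)
  obtain ⟨v₀, hv₀⟩ : Q.Nonempty := Finset.card_pos.1 (by rw [hQ.card_eq]; exact ht1)
  have hsub : ∀ i, ∃ A : Finset V, i < a c → A ⊆ nbrs G (!c) v₀ (F c i) ∧ A.card = t := by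
    intro i
    by_cases hi : i < a c
    · obtain ⟨A, hA, hc⟩ := Finset.exists_subset_card_eq
        ((Finset.mem_filter.1 (hQW v₀ hv₀)).2 c i hi)
      exact ⟨A, fun _ => ⟨hA, hc⟩⟩
    · exact ⟨∅, fun h => absurd h hi⟩
  choose F' hF' using hsub
  refine ⟨c, _, ((hF c).of_subset (fun i hi u hu => (mem_nbrs.1 ((hF' i hi).1 hu)).1)
    fun i hi => (hF' i hi).2).snoc hQ fun i hi u hu v hv => ?_⟩
  have hu' := mem_nbrs.1 ((hF' i hi).1 hu)
  refine (htype v₀ hv₀ v hv u ?_ hu'.2).symm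
  simp only [U, Finset.mem_biUnion, Finset.mem_univ, true_and, Finset.mem_range]
  exact ⟨c, i, hi, hu'.1⟩

/-- A book-free coloring of a large complete graph has `k` cliques of order `s` of one color that
are joined completely in the other color. -/
theorem BookFree.exists_isMultipartite {V : Type*} [Fintype V] [DecidableEq V]
    {G : Bool → SimpleGraph V} {k n s : ℕ} (hG : IsColoring G) (hb : BookFree G k n) (hk : 3 ≤ k)
    (hs : 4 * k ^ 2 ≤ s) (hn : 2 ^ k * n ≤ Fintype.card V)
    (hV : 2 ^ (3 + (2 * k + 2) * ((4 * k) ^ (2 * k) * s)) ≤ Fintype.card V) :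
    ∃ c F, IsMultipartite G c k s F := by
  have main : ∀ r ≤ 2 * k, ∃ (a : Bool → ℕ) (F : Bool → ℕ → Finset V),
      (∀ c, IsMultipartite G c (a c) ((4 * k) ^ (2 * k - r) * s) (F c)) ∧
        (r ≤ a true + a false ∨ ∃ c, k ≤ a c) := by
    intro r
    induction r with
    | zero =>
      exact fun _ => ⟨fun _ => 0, fun _ _ => ∅, fun c => ⟨by simp, by simp, by simp⟩, by simp⟩
    | succ r ih =>
      intro hr
      obtain ⟨a, F, hF, hor⟩ := ih (by omega)
      set t := (4 * k) ^ (2 * k - (r + 1)) * s with htdef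
      have hst : (4 * k) ^ (2 * k - r) * s = 4 * k * t := by
        rw [htdef, show 2 * k - r = 2 * k - (r + 1) + 1 by omega, pow_succ]; ring
      have htle : t ≤ 4 * k * t := Nat.le_mul_of_pos_left t (by omega)
      rw [hst] at hF
      have htrim : ∀ c, ∃ F', IsMultipartite G c (a c) t F' := fun c => (hF c).exists_trim htle
      choose T hT using htrim
      by_cases hfull : ∃ c, k ≤ a c
      · exact ⟨a, T, hT, Or.inr hfull⟩
      · have hr' := hor.resolve_right hfull
        push Not at hfull
        have hs4 : 4 * k ^ 2 ≤ t :=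
          hs.trans (Nat.le_mul_of_pos_left s (pow_pos (by omega) _))
        have hm : 4 * k * t ≤ (4 * k) ^ (2 * k) * s := by
          rw [← hst]
          exact Nat.mul_le_mul_right _ (Nat.pow_le_pow_right (by omega) (by omega))
        have hV' : 6 * (2 ^ (2 * k * (4 * k * t)) * 2 ^ (t + t)) ≤ Fintype.card V := by
          refine le_trans ?_ hV
          rw [pow_add 2 3, ← pow_add 2]
          refine Nat.mul_le_mul (by norm_num) (Nat.pow_le_pow_right (by norm_num) ?_)
          have := Nat.mul_le_mul_left (2 * k) hm
          rw [add_mul (2 * k) 2]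
          omega
        obtain ⟨c, F', hF'⟩ :=
          hb.exists_isMultipartite_succ hG hk hs4 hn hV' hfull hF
        refine ⟨Function.update a c (a c + 1), Function.update T c F', fun d => ?_, Or.inl ?_⟩
        · rcases eq_or_ne d c with rfl | hd
          · simpa using hF'
          · simpa [hd] using hT d
        · cases c <;> simp <;> omega
  obtain ⟨a, F, hF, hor⟩ := main (2 * k) le_rfl
  obtain ⟨c, hc⟩ : ∃ c, k ≤ a c := by
    rcases hor with h | h
    · by_contra! hlt
      have := hlt true
      have := hlt false
      omega
    · exact h
  have := (hF c).mono hc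
  rw [Nat.sub_self, pow_zero, one_mul] at this
  exact ⟨c, F c, this⟩

/-! ### The upper bound -/

/-- The red graph (`true`) and the blue graph (`false`) of an edge labeling. -/
def colorGraphs {N : ℕ} (C : SimpleGraph.TopEdgeLabeling (Fin N) (Fin 2)) :
    Bool → SimpleGraph (Fin N) :=
  fun c => C.labelGraph (bif c then 0 else 1)

theorem isColoring_colorGraphs {N : ℕ} (C : SimpleGraph.TopEdgeLabeling (Fin N) (Fin 2)) :
    IsColoring (colorGraphs C) := by
  intro c u v huv
  have h : ∀ x : Fin 2, x = 1 ↔ ¬ x = 0 := by decide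
  have h' : ∀ x : Fin 2, x = 0 ↔ ¬ x = 1 := by decide
  cases c <;> simp only [colorGraphs, SimpleGraph.EdgeLabeling.labelGraph_adj,
    SimpleGraph.top_adj, cond_true, cond_false, Bool.not_true, Bool.not_false,
    exists_prop_of_true huv]
  · exact h' _
  · exact h _

/-- A clique with at least `n` common neighbors spans a book. -/
theorem bookGraph_isContained {N k n : ℕ} {G : SimpleGraph (Fin N)} (f : Fin k → Fin N)
    (hf : ∀ i j, i ≠ j → G.Adj (f i) (f j)) (hn : n ≤ {v | ∀ i, G.Adj v (f i)}.ncard) :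
    (bookGraph k n).IsContained G := by
  classical
  set S : Set (Fin N) := {v | ∀ i, G.Adj v (f i)} with hS
  obtain ⟨e⟩ : Nonempty (Fin n ↪ S) := by
    apply Function.Embedding.nonempty_of_card_le
    rw [Fintype.card_fin, ← Nat.card_eq_fintype_card]
    exact hn
  have he : ∀ i j, G.Adj (e j : Fin N) (f i) := fun i j => (e j).2 i
  have hadj : ∀ {x y : Fin k ⊕ Fin n}, (bookGraph k n).Adj x y →
      G.Adj (Sum.elim f (fun j => (e j : Fin N)) x) (Sum.elim f (fun j => (e j : Fin N)) y) := by
    rintro (i | i) (j | j) ⟨hne, hor⟩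
    · exact hf i j fun h => hne (h ▸ rfl)
    · exact (he i j).symm
    · exact he j i
    · simp at hor
  refine ⟨⟨⟨Sum.elim f fun j => (e j : Fin N), hadj⟩, ?_⟩⟩
  rintro (i | i) (j | j) h
  · by_contra hne
    exact (hf i j fun h => hne (h ▸ rfl)).ne h
  · exact absurd h.symm (he i j).ne
  · exact absurd h (he j i).ne
  · exact congrArg Sum.inr (e.injective (Subtype.ext h))

theorem bookFree_colorGraphs {N k n : ℕ} {C : SimpleGraph.TopEdgeLabeling (Fin N) (Fin 2)}
    (h0 : ¬ (bookGraph k n).IsContained (C.labelGraph 0))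
    (h1 : ¬ (bookGraph k n).IsContained (C.labelGraph 1)) : BookFree (colorGraphs C) k n := by
  intro c f hf
  by_contra! h
  cases c
  · exact h1 (bookGraph_isContained f hf h)
  · exact h0 (bookGraph_isContained f hf h)

/-- The upper bound with explicit dependence: an error of `ε * n` is allowed as soon as `n` is
exponential in `1 / ε`, for fixed `k`. The parameter `s` is the order of the cliques. -/
theorem isRamsey_bookGraph_of_large {k n s N : ℕ} {ε : ℝ} (hk : 3 ≤ k) (hε : ε ≤ 1)
    (hs : 2 ^ (2 * k + 1) * k ^ 2 ≤ ε * s)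
    (hn : 2 ^ (3 + (2 * k + 2) * ((4 * k) ^ (2 * k) * s)) ≤ n)
    (hN : 2 ^ k * n + ε * n - 1 < N) (hN2 : (N : ℝ) ≤ 2 ^ (k + 1) * n) :
    IsRamsey (bookGraph k n) (bookGraph k n) N := by
  intro C
  by_contra hC
  rw [not_or] at hC
  have hb := bookFree_colorGraphs hC.1 hC.2
  have hG := isColoring_colorGraphs C
  have hk1 : (3 : ℝ) ≤ k := by exact_mod_cast hk
  have hk2 : (1 : ℝ) ≤ k ^ 2 := by nlinarith
  have hεs : (0 : ℝ) < ε * s := lt_of_lt_of_le (by positivity) hs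
  have hs0 : (0 : ℝ) < s := by
    rcases (Nat.cast_nonneg (α := ℝ) s).eq_or_lt with h | h
    · rw [← h, mul_zero] at hεs; exact absurd hεs (lt_irrefl _)
    · exact h
  have hε0 : 0 < ε := pos_of_mul_pos_left hεs hs0.le
  have hs4 : 4 * k ^ 2 ≤ s := by
    have h1 : ε * s ≤ s := mul_le_of_le_one_left hs0.le hε
    have h2 : (4 : ℝ) * k ^ 2 ≤ 2 ^ (2 * k + 1) * k ^ 2 := by
      gcongr
      calc (4 : ℝ) = 2 ^ 2 := by norm_num
        _ ≤ _ := pow_le_pow_right₀ (by norm_num) (by omega)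
    exact_mod_cast h2.trans (hs.trans h1)
  -- The error coming from the cliques themselves is negligible.
  have hbig : (8 : ℝ) * s * (k * s + 1) ≤ n := by
    have h1 : 8 * s * (k * s + 1) ≤ 2 ^ (3 + (2 * k + 2) * ((4 * k) ^ (2 * k) * s)) := by
      have h2 : s ≤ 2 ^ s := Nat.lt_two_pow_self.le
      have h3 : k * s + 1 ≤ 2 ^ (k * s) := Nat.lt_two_pow_self
      have h4 : s ≤ (4 * k) ^ (2 * k) * s := Nat.le_mul_of_pos_left s (pow_pos (by omega) _)
      calc 8 * s * (k * s + 1) ≤ 2 ^ 3 * 2 ^ s * 2 ^ (k * s) := by gcongr; norm_num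
        _ = 2 ^ (3 + (k + 1) * s) := by rw [← pow_add, ← pow_add]; ring_nf
        _ ≤ _ := by
          refine Nat.pow_le_pow_right (by norm_num) (Nat.add_le_add_left ?_ 3)
          exact Nat.mul_le_mul (by omega) h4
    exact_mod_cast h1.trans hn
  have hn0 : (0 : ℝ) ≤ n := Nat.cast_nonneg n
  have hεn : 8 * (k * s + 1) ≤ ε * n := by
    have h1 : 1 ≤ ε * s := le_trans (by
      have : (1 : ℝ) ≤ 2 ^ (2 * k + 1) := one_le_pow₀ (by norm_num)
      nlinarith) hs
    have h2 := mul_le_mul_of_nonneg_left hbig hε0.le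
    have h3 : (0 : ℝ) ≤ 8 * (k * s + 1) := by positivity
    nlinarith [mul_le_mul_of_nonneg_right h1 h3]
  have hks : (0 : ℝ) ≤ k * s := by positivity
  have hnN : 2 ^ k * n ≤ N := by
    have : (2 : ℝ) ^ k * n < N := by linarith
    exact_mod_cast this.le
  have hnN' : n ≤ N := le_trans (Nat.le_mul_of_pos_left n (by positivity)) hnN
  obtain ⟨c, F, hF⟩ := hb.exists_isMultipartite hG hk hs4 (by simpa using hnN)
    (by simpa using hn.trans hnN')
  have hs0' : 0 < s := by exact_mod_cast hs0
  have h := hb.card_mul_two_le hG hk hs0' hF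
  rw [Fintype.card_fin] at h
  have h2 : 2 ^ k * ((k : ℝ) ^ 2 * N / s) ≤ ε * n := by
    rw [mul_div_assoc', div_le_iff₀ hs0]
    calc (2 : ℝ) ^ k * (k ^ 2 * N) ≤ 2 ^ k * (k ^ 2 * (2 ^ (k + 1) * n)) := by gcongr
      _ = ((2 : ℝ) ^ (2 * k + 1) * (k : ℝ) ^ 2) * n := by ring
      _ ≤ (ε * s) * n := by gcongr
      _ = _ := by ring
  have h3 : ((N : ℝ) - k * s) * 2 ≤ 2 * (2 ^ k * n) + ε * n := by
    rw [mul_add] at h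
    linarith
  linarith

theorem lt_two_rpow {x : ℝ} (hx : 0 ≤ x) : x < 2 ^ x := by
  have h1 : ((⌊x⌋₊ + 1 : ℕ) : ℝ) ≤ ((2 ^ ⌊x⌋₊ : ℕ) : ℝ) := Nat.cast_le.2 Nat.lt_two_pow_self
  push_cast at h1
  calc x < ⌊x⌋₊ + 1 := Nat.lt_floor_add_one x
    _ ≤ 2 ^ ⌊x⌋₊ := h1
    _ = (2 : ℝ) ^ (⌊x⌋₊ : ℝ) := (Real.rpow_natCast 2 _).symm
    _ ≤ 2 ^ x := Real.rpow_le_rpow_of_exponent_le (by norm_num) (Nat.floor_le hx)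

theorem sq_div_four_lt_two_rpow {x : ℝ} (hx : 0 ≤ x) : x ^ 2 / 4 < 2 ^ x := by
  have h1 := lt_two_rpow (x := x / 2) (by linarith)
  have h2 : (2 : ℝ) ^ x = (2 ^ (x / 2)) ^ 2 := by
    rw [← Real.rpow_natCast, ← Real.rpow_mul (by norm_num)]
    congr 1; push_cast; ring
  rw [h2]
  nlinarith

theorem natCast_le_logb_of_two_pow_le {m : ℕ} {x : ℝ} (h : ((2 ^ m : ℕ) : ℝ) ≤ x) :
    (m : ℝ) ≤ Real.logb 2 x := by
  have hx : 0 < x := lt_of_lt_of_le (by positivity) h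
  rw [Real.le_logb_iff_rpow_le (by norm_num) hx, Real.rpow_natCast]
  exact_mod_cast h

/-- The constants depending on `k` are absorbed by the lower bound on `n`. -/
theorem constant_le_two_pow {k : ℕ} (hk : 3 ≤ k) :
    4 * (3 + (2 * k + 2) * ((4 * k) ^ (2 * k) * (2 ^ (2 * k + 2) * k ^ 2))) ≤
      k ^ (25 * k ^ 2) * 2 ^ (100 * k ^ 3) := by
  have h1 : k ≤ 2 ^ k := Nat.lt_two_pow_self.le
  have h2 : k + 1 ≤ 2 ^ k := Nat.lt_two_pow_self
  have h3 : (2 * k + 2) * ((4 * k) ^ (2 * k) * (2 ^ (2 * k + 2) * k ^ 2)) ≤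
      2 ^ (2 * k ^ 2 + 9 * k + 3) := by
    calc (2 * k + 2) * ((4 * k) ^ (2 * k) * (2 ^ (2 * k + 2) * k ^ 2))
        = 2 * (k + 1) * ((2 ^ 2 * k) ^ (2 * k) * (2 ^ (2 * k + 2) * k ^ 2)) := by ring
      _ ≤ 2 * 2 ^ k * ((2 ^ 2 * 2 ^ k) ^ (2 * k) * (2 ^ (2 * k + 2) * (2 ^ k) ^ 2)) := by gcongr
      _ = 2 ^ (2 * k ^ 2 + 9 * k + 3) := by
          rw [← pow_add, ← pow_mul, ← pow_mul, ← pow_succ', ← pow_add, ← pow_add, ← pow_add]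
          congr 1; ring
  have h4 : 3 ≤ 2 ^ (2 * k ^ 2 + 9 * k + 3) :=
    le_trans (by norm_num) (Nat.pow_le_pow_right (n := 2) (i := 2) (by norm_num) (by omega))
  calc 4 * (3 + (2 * k + 2) * ((4 * k) ^ (2 * k) * (2 ^ (2 * k + 2) * k ^ 2)))
      ≤ 4 * (2 ^ (2 * k ^ 2 + 9 * k + 3) + 2 ^ (2 * k ^ 2 + 9 * k + 3)) := by gcongr
    _ = 2 ^ (2 * k ^ 2 + 9 * k + 6) := by rw [pow_add _ _ 3, pow_add _ _ 6]; ring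
    _ ≤ 2 ^ (100 * k ^ 3) := by
        refine Nat.pow_le_pow_right (by norm_num) ?_
        have e1 : k ^ 2 ≤ k ^ 3 := Nat.pow_le_pow_right (by omega) (by norm_num)
        have e2 : k ≤ k ^ 3 := Nat.le_self_pow (by norm_num) k
        omega
    _ ≤ _ := Nat.le_mul_of_pos_left _ (pow_pos (by omega) _)

theorem ramseyNumber_bookGraph_le {k n : ℕ} (hk : 3 ≤ k)
    (hn : 2 ^ 2 ^ 2 ^ (k ^ (25 * k ^ 2) * 2 ^ (100 * k ^ 3)) ≤ n) :
    (ramseyNumber (bookGraph k n) : ℝ) ≤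
      2 ^ k * n + n / (Real.logb 2 (Real.logb 2 (Real.logb 2 n))) ^ (1 / 25 : ℝ) := by
  have hA := constant_le_two_pow hk
  set K := k ^ (25 * k ^ 2) * 2 ^ (100 * k ^ 3)
  set A := 3 + (2 * k + 2) * ((4 * k) ^ (2 * k) * (2 ^ (2 * k + 2) * k ^ 2)) with hAdef
  have hz : ((2 ^ 2 ^ K : ℕ) : ℝ) ≤ Real.logb 2 n :=
    natCast_le_logb_of_two_pow_le (Nat.cast_le.2 hn)
  have hy := natCast_le_logb_of_two_pow_le hz
  have hL := natCast_le_logb_of_two_pow_le hy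
  have hn0 : (0 : ℝ) < n := lt_of_lt_of_le (by positivity) (Nat.cast_le (α := ℝ).2 hn)
  have hz0 : 0 < Real.logb 2 n := lt_of_lt_of_le (by positivity) hz
  have hy0 : 0 < Real.logb 2 (Real.logb 2 n) := lt_of_lt_of_le (by positivity) hy
  have hn_eq : (2 : ℝ) ^ Real.logb 2 n = n := Real.rpow_logb (by norm_num) (by norm_num) hn0
  have hz_eq : (2 : ℝ) ^ Real.logb 2 (Real.logb 2 n) = Real.logb 2 n :=
    Real.rpow_logb (by norm_num) (by norm_num) hz0
  have hy_eq := Real.rpow_logb (b := 2) (by norm_num) (by norm_num) hy0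
  set z := Real.logb 2 n
  set y := Real.logb 2 z
  set L := Real.logb 2 y
  have hAL : 4 * (A : ℝ) ≤ L := le_trans (by exact_mod_cast hA) hL
  have hA1 : (3 : ℝ) ≤ A := by rw [hAdef]; exact_mod_cast Nat.le_add_right 3 _
  have hL1 : 1 ≤ L := by linarith
  have hroot1 : 1 ≤ L ^ (1 / 25 : ℝ) := Real.one_le_rpow hL1 (by norm_num)
  have hrootL : L ^ (1 / 25 : ℝ) ≤ L := by
    conv_rhs => rw [← Real.rpow_one L]
    exact Real.rpow_le_rpow_of_exponent_le hL1 (by norm_num)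
  set ρ := L ^ (1 / 25 : ℝ)
  have hρ0 : 0 < ρ := by linarith
  have hLz : L ^ 2 / 4 ≤ z := by
    calc L ^ 2 / 4 ≤ 2 ^ L := (sq_div_four_lt_two_rpow (by linarith)).le
      _ = y := hy_eq
      _ ≤ 2 ^ y := (lt_two_rpow hy0.le).le
      _ = z := hz_eq
  set q : ℕ := 2 ^ (2 * k + 1) * k ^ 2 with hq
  have hq1 : (1 : ℝ) ≤ q := by
    exact_mod_cast (Nat.mul_pos (by positivity) (pow_pos (by omega) 2) : 0 < q)
  have hsq : (⌈(q : ℝ) * ρ⌉₊ : ℝ) ≤ 2 * q * L := by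
    have h1 := Nat.ceil_lt_add_one (a := (q : ℝ) * ρ) (by positivity)
    nlinarith [mul_le_mul_of_nonneg_left hrootL (by linarith : (0 : ℝ) ≤ q)]
  set s := ⌈(q : ℝ) * ρ⌉₊
  have hexp : ((3 + (2 * k + 2) * ((4 * k) ^ (2 * k) * s) : ℕ) : ℝ) ≤ z := by
    refine le_trans ?_ hLz
    have h2q : (2 * q : ℕ) = 2 ^ (2 * k + 2) * k ^ 2 := by rw [hq]; ring
    have hAe : (A : ℝ) = 3 + (2 * k + 2) * ((4 * k) ^ (2 * k) * (2 * q)) := by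
      rw [hAdef, ← h2q]; push_cast; ring
    calc ((3 + (2 * k + 2) * ((4 * k) ^ (2 * k) * s) : ℕ) : ℝ)
        = 3 + (2 * k + 2) * ((4 * k) ^ (2 * k) * s) := by push_cast; ring
      _ ≤ 3 * L + (2 * k + 2) * ((4 * k) ^ (2 * k) * (2 * q * L)) := by gcongr; linarith
      _ = A * L := by rw [hAe]; ring
      _ ≤ L ^ 2 / 4 := by nlinarith
  have hnexp : 2 ^ (3 + (2 * k + 2) * ((4 * k) ^ (2 * k) * s)) ≤ n := by
    have : (2 : ℝ) ^ (3 + (2 * k + 2) * ((4 * k) ^ (2 * k) * s)) ≤ n := by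
      rw [← hn_eq, ← Real.rpow_natCast]
      exact Real.rpow_le_rpow_of_exponent_le (by norm_num) hexp
    exact_mod_cast this
  have hρinv : ρ⁻¹ ≤ 1 := inv_le_one_of_one_le₀ hroot1
  have hN0 : 0 ≤ 2 ^ k * (n : ℝ) + ρ⁻¹ * n := by positivity
  have hR : IsRamsey (bookGraph k n) (bookGraph k n) ⌊2 ^ k * (n : ℝ) + ρ⁻¹ * n⌋₊ := by
    refine isRamsey_bookGraph_of_large hk hρinv ?_ hnexp ?_ ?_
    · have h1 : (q : ℝ) * ρ ≤ s := Nat.le_ceil _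
      have h2 : (q : ℝ) = 2 ^ (2 * k + 1) * k ^ 2 := by rw [hq]; push_cast; ring
      rw [← h2, inv_mul_eq_div, le_div_iff₀ hρ0]
      exact h1
    · have := Nat.lt_floor_add_one (2 ^ k * (n : ℝ) + ρ⁻¹ * n)
      linarith
    · refine (Nat.floor_le hN0).trans ?_
      have h1 : ρ⁻¹ * n ≤ 2 ^ k * (n : ℝ) := by
        gcongr
        exact hρinv.trans (one_le_pow₀ (by norm_num))
      rw [pow_succ]; linarith
  calc (ramseyNumber (bookGraph k n) : ℝ) ≤ ⌊2 ^ k * (n : ℝ) + ρ⁻¹ * n⌋₊ :=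
        Nat.cast_le.2 (Nat.sInf_le hR)
    _ ≤ 2 ^ k * (n : ℝ) + ρ⁻¹ * n := Nat.floor_le hN0
    _ = _ := by rw [inv_mul_eq_div]

/-! ### The lower bound: random colorings -/

theorem card_filter_eq_const_mul {α : Type*} [Fintype α] [DecidableEq α] (A : Finset α)
    (c : Fin 2) :
    (Finset.univ.filter fun g : α → Fin 2 => ∀ e ∈ A, g e = c).card * 2 ^ A.card =
      2 ^ Fintype.card α := by
  have h : (Finset.univ.filter fun g : α → Fin 2 => ∀ e ∈ A, g e = c) =
      Fintype.piFinset fun e => if e ∈ A then {c} else Finset.univ := by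
    ext g
    simp only [Finset.mem_filter, Finset.mem_univ, true_and, Fintype.mem_piFinset]
    refine forall_congr' fun e => ?_
    by_cases he : e ∈ A <;> simp [he]
  have h2 : ∀ e : α, (if e ∈ A then ({c} : Finset (Fin 2)) else Finset.univ).card =
      if e ∈ A then 1 else 2 := by
    intro e; split_ifs <;> simp
  rw [h, Fintype.card_piFinset, Finset.prod_congr rfl fun e _ => h2 e,
    Finset.prod_ite, Finset.prod_const_one, one_mul, Finset.prod_const, ← pow_add]
  congr 1
  have := Finset.card_filter_add_card_filter_not (s := (Finset.univ : Finset α)) (· ∈ A)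
  rw [Finset.card_univ, Finset.filter_univ_mem] at this
  omega

/-- The pages of color `c` on the spine `f` in the coloring `g`. -/
def pages {N k : ℕ} (g : Sym2 (Fin N) → Fin 2) (c : Fin 2) (f : Fin k → Fin N) :
    Finset (Fin N) :=
  (Finset.univ.image f)ᶜ.filter fun v => ∀ i, g s(v, f i) = c

/-- The exponential moment of the number of pages on a fixed spine, which is binomially distributed
with success probability `2 ^ (-k)`. -/
theorem sum_one_add_pow_card_pages {N k : ℕ} (c : Fin 2) {f : Fin k → Fin N}
    (hf : Function.Injective f) (l : ℝ) :
    ∑ g : Sym2 (Fin N) → Fin 2, (1 + l) ^ (pages g c f).card =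
      2 ^ Fintype.card (Sym2 (Fin N)) * (1 + l / 2 ^ k) ^ (Finset.univ.image f)ᶜ.card := by
  classical
  set R : Finset (Fin N) := (Finset.univ.image f)ᶜ
  have hexpand : ∀ g : Sym2 (Fin N) → Fin 2, (1 + l) ^ (pages g c f).card =
      ∑ T ∈ R.powerset, if ∀ v ∈ T, ∀ i, g s(v, f i) = c then l ^ T.card else 0 := by
    intro g
    rw [← Finset.prod_const, Finset.prod_one_add, ← Finset.sum_filter]
    refine Finset.sum_congr ?_ fun T _ => Finset.prod_const _
    ext T
    simp only [Finset.mem_powerset, Finset.mem_filter, pages, Finset.subset_iff]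
    exact ⟨fun h => ⟨fun v hv => (h hv).1, fun v hv => (h hv).2⟩,
      fun h v hv => ⟨h.1 hv, h.2 v hv⟩⟩
  have hcount : ∀ T ∈ R.powerset,
      ∑ g : Sym2 (Fin N) → Fin 2, (if ∀ v ∈ T, ∀ i, g s(v, f i) = c then l ^ T.card else 0) =
        2 ^ Fintype.card (Sym2 (Fin N)) * (l / 2 ^ k) ^ T.card := by
    intro T hT
    have hTR : ∀ v ∈ T, ∀ i, v ≠ f i := fun v hv i h =>
      Finset.mem_compl.1 (Finset.mem_powerset.1 hT hv) (h ▸ Finset.mem_image_of_mem f (by simp))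
    let A : Finset (Sym2 (Fin N)) := (T ×ˢ Finset.univ).image fun p : _ × Fin k => s(p.1, f p.2)
    have hAcard : A.card = k * T.card := by
      rw [Finset.card_image_of_injOn, Finset.card_product, Finset.card_univ, Fintype.card_fin,
        mul_comm]
      rintro ⟨v, i⟩ hv ⟨w, j⟩ hw h
      simp only [Finset.coe_product, Set.mem_prod, Finset.mem_coe] at hv hw
      rcases Sym2.eq_iff.1 h with ⟨h1, h2⟩ | ⟨h1, h2⟩
      · exact Prod.ext h1 (hf h2)
      · exact absurd h1 (hTR v hv.1 j)
    have hA := card_filter_eq_const_mul A c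
    have hfilter : (Finset.univ.filter fun g : Sym2 (Fin N) → Fin 2 => ∀ e ∈ A, g e = c) =
        Finset.univ.filter fun g => ∀ v ∈ T, ∀ i, g s(v, f i) = c := by
      ext g
      simp only [Finset.mem_filter, Finset.mem_univ, true_and, A, Finset.mem_image,
        Finset.mem_product, Prod.exists, and_true]
      exact ⟨fun h v hv i => h _ ⟨v, i, hv, rfl⟩, by rintro h e ⟨v, i, hv, rfl⟩; exact h v hv i⟩
    rw [hfilter, hAcard] at hA
    rw [← Finset.sum_filter, Finset.sum_const, nsmul_eq_mul]
    have hA' : ((Finset.univ.filter fun g : Sym2 (Fin N) → Fin 2 =>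
        ∀ v ∈ T, ∀ i, g s(v, f i) = c).card : ℝ) * 2 ^ (k * T.card) =
          2 ^ Fintype.card (Sym2 (Fin N)) := by exact_mod_cast hA
    rw [← hA', div_pow, ← pow_mul]
    field_simp
  rw [Finset.sum_congr rfl fun g _ => hexpand g, Finset.sum_comm, Finset.sum_congr rfl hcount,
    ← Finset.mul_sum, ← Finset.prod_const, Finset.prod_one_add]
  congr 1
  exact Finset.sum_congr rfl fun T _ => (Finset.prod_const _).symm

/-- The first moment method, with `(1 + l) ^ X` bounding the indicator of `X ≥ n` up to the factor
`(1 + l) ^ n`. -/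
theorem not_isRamsey_bookGraph {k n N : ℕ} {l : ℝ} (hl : 0 ≤ l)
    (h : 2 * (N : ℝ) ^ k * (1 + l / 2 ^ k) ^ N < (1 + l) ^ n) :
    ¬ IsRamsey (bookGraph k n) (bookGraph k n) N := by
  classical
  intro hR
  have hex : ∀ g : Sym2 (Fin N) → Fin 2, ∃ (c : Fin 2) (f : Fin k → Fin N),
      Function.Injective f ∧ n ≤ (pages g c f).card := by
    intro g
    have key : ∀ c : Fin 2, (bookGraph k n).IsContained
        (SimpleGraph.EdgeLabeling.labelGraph (G := (⊤ : SimpleGraph (Fin N))) (fun e => g e) c) →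
        ∃ f : Fin k → Fin N, Function.Injective f ∧ n ≤ (pages g c f).card := by
      rintro c ⟨φ⟩
      refine ⟨fun i => φ (Sum.inl i), fun i j hij => Sum.inl.inj (φ.injective hij), ?_⟩
      have hsub : Finset.univ.image (fun j => φ (Sum.inr j)) ⊆
          pages g c fun i => φ (Sum.inl i) := by
        intro v hv
        obtain ⟨j, -, rfl⟩ := Finset.mem_image.1 hv
        simp only [pages, Finset.mem_filter, Finset.mem_compl, Finset.mem_image, Finset.mem_univ,
          true_and, not_exists]
        refine ⟨fun i hi => Sum.inl_ne_inr (φ.injective hi), fun i => ?_⟩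
        have hadj : (bookGraph k n).Adj (Sum.inr j) (Sum.inl i) := ⟨Sum.inr_ne_inl, by simp⟩
        exact ((SimpleGraph.EdgeLabeling.labelGraph_adj _ _).1 (φ.toHom.map_adj hadj)).2
      have hcard := Finset.card_le_card hsub
      have hinj : Function.Injective fun j => φ (Sum.inr j) :=
        fun a b hab => Sum.inr.inj (φ.injective hab)
      rwa [Finset.card_image_of_injective _ hinj,
        Finset.card_univ, Fintype.card_fin] at hcard
    rcases hR (fun e => g e) with h0 | h1
    · exact ⟨0, key 0 h0⟩
    · exact ⟨1, key 1 h1⟩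
  set E := Fintype.card (Sym2 (Fin N)) with hE
  let J : Finset (Fin k → Fin N) := Finset.univ.filter Function.Injective
  have hpt : ∀ g : Sym2 (Fin N) → Fin 2, (1 + l) ^ n ≤
      ∑ p ∈ (Finset.univ : Finset (Fin 2)) ×ˢ J, (1 + l) ^ (pages g p.1 p.2).card := by
    intro g
    obtain ⟨c, f, hf, hn⟩ := hex g
    refine (pow_le_pow_right₀ (by linarith) hn).trans
      (Finset.single_le_sum (f := fun p : Fin 2 × (Fin k → Fin N) =>
        (1 + l) ^ (pages g p.1 p.2).card) (a := (c, f)) (fun p _ => by positivity) ?_)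
    simp [J, hf]
  have hsum : (2 : ℝ) ^ E * (1 + l) ^ n ≤ 2 ^ E * (2 * (N : ℝ) ^ k * (1 + l / 2 ^ k) ^ N) := by
    calc (2 : ℝ) ^ E * (1 + l) ^ n = ∑ _g : Sym2 (Fin N) → Fin 2, (1 + l) ^ n := by
          simp [hE]
      _ ≤ ∑ g : Sym2 (Fin N) → Fin 2,
            ∑ p ∈ (Finset.univ : Finset (Fin 2)) ×ˢ J, (1 + l) ^ (pages g p.1 p.2).card :=
          Finset.sum_le_sum fun g _ => hpt g
      _ = ∑ p ∈ (Finset.univ : Finset (Fin 2)) ×ˢ J,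
            ∑ g : Sym2 (Fin N) → Fin 2, (1 + l) ^ (pages g p.1 p.2).card := Finset.sum_comm
      _ ≤ ∑ p ∈ (Finset.univ : Finset (Fin 2)) ×ˢ J, 2 ^ E * (1 + l / 2 ^ k) ^ N := by
          refine Finset.sum_le_sum fun p hp => ?_
          have hf : Function.Injective p.2 :=
            (Finset.mem_filter.1 (Finset.mem_product.1 hp).2).2
          rw [sum_one_add_pow_card_pages p.1 hf l]
          refine mul_le_mul_of_nonneg_left (pow_le_pow_right₀ ?_ ?_) (by positivity)
          · have : 0 ≤ l / 2 ^ k := by positivity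
            linarith
          · exact (Finset.card_le_univ _).trans (by simp)
      _ ≤ (2 * (N : ℝ) ^ k) * (2 ^ E * (1 + l / 2 ^ k) ^ N) := by
          rw [Finset.sum_const, nsmul_eq_mul]
          have hJ : ((Finset.univ : Finset (Fin 2)) ×ˢ J).card ≤ 2 * N ^ k := by
            rw [Finset.card_product]
            refine Nat.mul_le_mul (by simp) ((Finset.card_le_univ _).trans ?_)
            simp
          gcongr
          exact_mod_cast hJ
      _ = _ := by ring
  exact absurd (le_of_mul_le_mul_left hsum (by positivity)) (not_le.2 h)

/-- With `n = x ^ 4` and the parameter `l = 1 / (2 x)`, the moment bound beats the number of spines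
when `N ≤ 2 ^ k * (n - n ^ (3 / 4))`. -/
theorem eventually_moment_lt (k : ℕ) : ∀ᶠ x : ℝ in Filter.atTop, ∀ n N : ℕ, x ^ 4 = n →
    (N : ℝ) ≤ 2 ^ k * (x ^ 4 - x ^ 3) →
      2 * (N : ℝ) ^ k * (1 + 1 / (2 * x) / 2 ^ k) ^ N < (1 + 1 / (2 * x)) ^ n := by
  have hlim := (Real.tendsto_pow_mul_exp_neg_atTop_nhds_zero (4 * k)).const_mul
    (2 * ((2 : ℝ) ^ k) ^ k)
  rw [mul_zero] at hlim
  filter_upwards [hlim.eventually_lt_const one_pos, Filter.eventually_ge_atTop 4]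
    with x hx hx4 n N hn hN
  have hx0 : 0 < x := by linarith
  have hN2 : (N : ℝ) ≤ 2 ^ k * x ^ 4 := hN.trans (by gcongr; linarith [pow_pos hx0 3])
  have h1 : (N : ℝ) ^ k ≤ (2 ^ k) ^ k * x ^ (4 * k) := by
    calc (N : ℝ) ^ k ≤ (2 ^ k * x ^ 4) ^ k := by gcongr
      _ = _ := by rw [mul_pow, ← pow_mul x]
  have h2 : 2 * (N : ℝ) ^ k < Real.exp x := by
    have h3 : 2 * (2 ^ k : ℝ) ^ k * x ^ (4 * k) < Real.exp x := by
      have h4 := mul_lt_mul_of_pos_right hx (Real.exp_pos x)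
      rw [one_mul, ← mul_assoc, mul_assoc _ (Real.exp (-x)), ← Real.exp_add, neg_add_cancel,
        Real.exp_zero, mul_one] at h4
      exact h4
    nlinarith
  have h3 : (1 + 1 / (2 * x) / 2 ^ k) ^ N ≤ Real.exp (x ^ 3 / 2 - x ^ 2 / 2) := by
    calc (1 + 1 / (2 * x) / 2 ^ k) ^ N ≤ Real.exp (1 / (2 * x) / 2 ^ k) ^ N := by
          gcongr
          linarith [Real.add_one_le_exp (1 / (2 * x) / 2 ^ k)]
      _ = Real.exp (N * (1 / (2 * x) / 2 ^ k)) := (Real.exp_nat_mul _ _).symm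
      _ ≤ Real.exp ((2 ^ k * (x ^ 4 - x ^ 3)) * (1 / (2 * x) / 2 ^ k)) := by gcongr
      _ = _ := by congr 1; field_simp
  have h4 : Real.exp (x ^ 3 / 2 - x ^ 2 / 4) ≤ (1 + 1 / (2 * x)) ^ n := by
    have hp : (0 : ℝ) < 1 + 1 / (2 * x) := by positivity
    have h5 := Real.one_sub_inv_le_log_of_pos hp
    have h6 : 1 / (2 * x) - 1 / (2 * x) ^ 2 ≤ 1 - (1 + 1 / (2 * x))⁻¹ := by
      have h7 : 1 - (1 + 1 / (2 * x))⁻¹ - (1 / (2 * x) - 1 / (2 * x) ^ 2) =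
          (1 / (2 * x)) ^ 3 / (1 + 1 / (2 * x)) := by field_simp; ring
      have h8 : 0 ≤ (1 / (2 * x)) ^ 3 / (1 + 1 / (2 * x)) := by positivity
      linarith
    calc Real.exp (x ^ 3 / 2 - x ^ 2 / 4)
        = Real.exp (n * (1 / (2 * x) - 1 / (2 * x) ^ 2)) := by
          rw [← hn]; congr 1; field_simp; ring
      _ ≤ Real.exp (n * Real.log (1 + 1 / (2 * x))) := by gcongr; linarith
      _ = _ := by rw [Real.exp_nat_mul, Real.exp_log hp]
  calc 2 * (N : ℝ) ^ k * (1 + 1 / (2 * x) / 2 ^ k) ^ N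
      < Real.exp x * Real.exp (x ^ 3 / 2 - x ^ 2 / 2) :=
        mul_lt_mul h2 h3 (by positivity) (Real.exp_pos _).le
    _ = Real.exp (x + (x ^ 3 / 2 - x ^ 2 / 2)) := (Real.exp_add _ _).symm
    _ ≤ Real.exp (x ^ 3 / 2 - x ^ 2 / 4) := by
        gcongr
        nlinarith
    _ ≤ _ := h4

theorem eventually_le_ramseyNumber (k : ℕ) : ∀ᶠ x : ℝ in Filter.atTop, ∀ n : ℕ, x ^ 4 = n →
    2 ^ k * (x ^ 4 - x ^ 3) ≤ ramseyNumber (bookGraph k n) := by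
  filter_upwards [eventually_moment_lt k, Filter.eventually_gt_atTop 0] with x hx hx0 n hn
  by_contra! hlt
  exact not_isRamsey_bookGraph (by positivity) (hx n _ hn hlt.le)
    (Nat.sInf_mem (exists_isRamsey (bookGraph k n) (bookGraph k n)))

/-! ### The asymptotic formula -/

theorem logb_two_lt {x : ℝ} (hx : 0 < x) : Real.logb 2 x < x := by
  rw [Real.logb_lt_iff_lt_rpow (by norm_num) hx]
  exact lt_two_rpow hx.le

theorem theorem1p2 (k : ℕ) (hk : 3 ≤ k) :
    (∀ n : ℕ, 2 ^ 2 ^ 2 ^ (k ^ (25 * k ^ 2) * 2 ^ (100 * k ^ 3)) ≤ n →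
      (ramseyNumber (bookGraph k n) : ℝ) ≤
        2 ^ k * n + n / (Real.logb 2 (Real.logb 2 (Real.logb 2 n))) ^ (1 / 25 : ℝ)) ∧
    (fun n : ℕ => (ramseyNumber (bookGraph k n) : ℝ) - 2 ^ k * n) =O[Filter.atTop]
      (fun n : ℕ => (n : ℝ) / (Real.logb 2 (Real.logb 2 (Real.logb 2 n))) ^ (1 / 25 : ℝ)) := by
  refine ⟨fun n hn => ramseyNumber_bookGraph_le hk hn, ?_⟩
  have hroot : Filter.Tendsto (fun n : ℕ => (n : ℝ) ^ (1 / 4 : ℝ)) Filter.atTop Filter.atTop :=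
    (tendsto_rpow_atTop (by norm_num)).comp tendsto_natCast_atTop_atTop
  refine Asymptotics.IsBigO.of_bound (2 ^ k) ?_
  filter_upwards [Filter.eventually_ge_atTop
      (2 ^ 2 ^ 2 ^ (k ^ (25 * k ^ 2) * 2 ^ (100 * k ^ 3))), Filter.eventually_ge_atTop (2 ^ 2 ^ 2 ^ 1),
    hroot.eventually (eventually_le_ramseyNumber k), hroot.eventually_ge_atTop 2]
    with n hnM hn16 hlow hx2
  have hup := ramseyNumber_bookGraph_le hk hnM
  have hx4 : ((n : ℝ) ^ (1 / 4 : ℝ)) ^ 4 = n := by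
    rw [← Real.rpow_natCast, ← Real.rpow_mul (Nat.cast_nonneg n)]
    norm_num
  have hlow' := hlow n hx4
  set x := (n : ℝ) ^ (1 / 4 : ℝ)
  have hx0 : 0 < x := by linarith
  have hz := natCast_le_logb_of_two_pow_le (Nat.cast_le (α := ℝ).2 hn16)
  have hy := natCast_le_logb_of_two_pow_le hz
  have hL := natCast_le_logb_of_two_pow_le hy
  norm_num at hz hy hL
  have hLx : Real.logb 2 (Real.logb 2 (Real.logb 2 n)) ≤ x ^ 25 := by
    have h1 : Real.logb 2 n ≤ 4 * x := by
      rw [← hx4, Real.logb_pow]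
      push_cast
      linarith [logb_two_lt hx0]
    have h2 := logb_two_lt (x := Real.logb 2 n) (by linarith)
    have h3 := logb_two_lt (x := Real.logb 2 (Real.logb 2 n)) (by linarith)
    have h4 : (2 : ℝ) ^ 24 ≤ x ^ 24 := pow_le_pow_left₀ (by norm_num) hx2 24
    have h5 : x ^ 25 = x ^ 24 * x := pow_succ _ _
    nlinarith
  set L := Real.logb 2 (Real.logb 2 (Real.logb 2 n))
  have hρ0 : 0 < L ^ (1 / 25 : ℝ) := Real.rpow_pos_of_pos (by linarith) _
  have hρ : L ^ (1 / 25 : ℝ) ≤ x := by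
    calc L ^ (1 / 25 : ℝ) ≤ (x ^ 25) ^ (1 / 25 : ℝ) :=
          Real.rpow_le_rpow (by linarith) hLx (by norm_num)
      _ = x := by
          rw [← Real.rpow_natCast, ← Real.rpow_mul hx0.le]
          norm_num
  have herr : x ^ 3 ≤ n / L ^ (1 / 25 : ℝ) := by
    rw [le_div_iff₀ hρ0, ← hx4]
    calc x ^ 3 * L ^ (1 / 25 : ℝ) ≤ x ^ 3 * x := by gcongr
      _ = x ^ 4 := by ring
  have herr0 : 0 ≤ n / L ^ (1 / 25 : ℝ) := by positivity
  have hk1 : (1 : ℝ) ≤ 2 ^ k := one_le_pow₀ (by norm_num)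
  rw [Real.norm_of_nonneg herr0, Real.norm_eq_abs, abs_le]
  constructor
  · rw [hx4] at hlow'
    nlinarith
  · nlinarith
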